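/- Let $\mathbb{F}$ be the real or complex field and let $\mathcal{I}$ be a nonempty countable (finite or infinite) set. A function norm over $\mathcal{I}$ is a map $\lambda\colon[0,\infty)^{\mathcal{I}}\to[0,\infty]$ such that, for all $f,g\in[0,\infty)^{\mathcal{I}}$ and $a\ge 0$: $\lambda(f)=0$ if and only if $f=0$; $\lambda(af)=a\lambda(f)$ (with $0\cdot\infty=0$); $\lambda(f+g)\le\lambda(f)+\lambda(g)$; $\lambda(f)\le\lambda(g)$ if $f\le g$; $\lambda(f_n)\uparrow\lambda(f)$ whenever $f_n\uparrow f$ pointwise; and, for each finite $E\subseteq\mathcal{I}$, $\lambda(\chi_E)<\infty$ and there is a constant $C_E<\infty$ with $\sum_{i\in E}f(i)\le C_E\,\lambda(f)$ for all $f$. Suppose that $\lambda(\chi_{\{i\}})=1$ for all $i\in\mathcal{I}$, and let $U=\{f\in\mathbb{F}^{\mathcal{I}}\colon \lambda(|f|)<\infty\}$, with norm $\lambda(|f|)$ and coordinatewise lattice operations, be the associated sequence space. For a Banach space $X$ let $U(X)$ be the space of all $f\colon\mathcal{I}\to X$ with $\|f\|_{U(X)}:=\lambda\big((\|f(i)\|_X)_{i\in\mathcal{I}}\big)<\infty$.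 For $r,s\in[1,\infty)$ let $L_s(L_r)$ be the space of (classes of) strongly measurable $s$-integrable functions on $[0,1]$ with values in $L_r=L_r([0,1])$, where $[0,1]$ carries Lebesgue measure in both cases. All function spaces are over $\mathbb{F}$, and $\ell_p=\ell_p(\mathbb{N})$. **Proposition 3.8.** Let $2<p<\infty$ and $r,s\in[1,\infty)$. Suppose that $U(\ell_p)$ isomorphically embeds in $L_s(L_r)$, i.e., there are a bounded linear map $J\colon U(\ell_p)\to L_s(L_r)$ and a constant $c>0$ with $\|Jx\|\ge c\|x\|$ for all $x\in U(\ell_p)$. Then \[ \min\{r,s\}\le p\le\max\{r,s\}. \] If, moreover, $r\le s$ and $p\neq r$, then $p=s$ and $U$ is lattice isomorphic to $\ell_p(\mathcal{I})$, i.e., there is a linear homeomorphism $T$ from $U$ onto $\ell_p(\mathcal{I})$ with $T(|f|)=|T(f)|$ for all $f\in U$. -/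

import Mathlib

open Filter Topology MeasureTheory
open scoped NNReal ENNReal

/-- A (Bennett–Sharpley) function norm over the counting measure on `ι`: a map from the
nonnegative functions on `ι` to `[0, ∞]` that is a monotone norm, has the Fatou property, is
finite on indicators of sets of finite measure, and controls the integral over such sets.
(For the counting measure: null sets are empty, sets of finite measure are the finite sets.) -/
structure FunctionNorm (ι : Type*) where
  /-- the underlying map -/
  toFun : (ι → ℝ≥0) → ℝ≥0∞
  eq_zero_iff' : ∀ f, toFun f = 0 ↔ f = 0
  smul' : ∀ (a : ℝ≥0) (f : ι → ℝ≥0), toFun (a • f) = a * toFun f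
  add_le' : ∀ f g, toFun (f + g) ≤ toFun f + toFun g
  mono' : ∀ f g, f ≤ g → toFun f ≤ toFun g
  fatou' : ∀ (f : ℕ → ι → ℝ≥0) (g : ι → ℝ≥0), Monotone f →
    (∀ i, Tendsto (fun n => f n i) atTop (𝓝 (g i))) →
    Tendsto (fun n => toFun (f n)) atTop (𝓝 (toFun g))
  indicator_lt_top' : ∀ E : Finset ι, toFun (Set.indicator (E : Set ι) 1) < ∞
  sum_le' : ∀ E : Finset ι, ∃ C : ℝ≥0, ∀ f : ι → ℝ≥0,
    ((∑ i ∈ E, f i : ℝ≥0) : ℝ≥0∞) ≤ C * toFun f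

namespace FunctionNorm

variable {ι : Type*}

/-- The function norm takes the value one at every unit vector; its function space is then
called a sequence space over `ι`. -/
def IsNormalized (ρ : FunctionNorm ι) : Prop :=
  ∀ i : ι, ρ.toFun (Set.indicator {i} 1) = 1

section VectorValued

variable (ρ : FunctionNorm ι) (𝕜 : Type*) [RCLike 𝕜]
  (X : Type*) [NormedAddCommGroup X] [NormedSpace 𝕜 X]

/-- The functions `f : ι → X` with `ρ(‖f‖) < ∞`, as a linear subspace of `X^ι`. -/
def submodule : Submodule 𝕜 (ι → X) where
  carrier := {f | ρ.toFun (fun i => ‖f i‖₊) < ∞}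
  zero_mem' := by
    have h : (fun i => ‖(0 : ι → X) i‖₊) = (0 : ι → ℝ≥0) := by ext i; simp
    simp only [Set.mem_ofPred_eq]
    rw [h, (ρ.eq_zero_iff' 0).2 rfl]
    exact ENNReal.zero_lt_top
  add_mem' := by
    intro f g hf hg
    refine lt_of_le_of_lt ?_ (ENNReal.add_lt_top.2 ⟨hf, hg⟩)
    exact (ρ.mono' _ _ (fun i => nnnorm_add_le (f i) (g i))).trans (ρ.add_le' _ _)
  smul_mem' := by
    intro c f hf
    have h : (fun i => ‖(c • f) i‖₊) = ‖c‖₊ • (fun i => ‖f i‖₊) := by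
      ext i; simp [nnnorm_smul]
    simp only [Set.mem_ofPred_eq]
    rw [h, ρ.smul']
    exact ENNReal.mul_lt_top ENNReal.coe_lt_top hf

/-- The vector-valued function space `L_ρ(X)`, which is also written `U(X)` if `U = L_ρ`. It is a
copy of `submodule` that does not inherit the product topology. The scalar-valued space `L_ρ`
itself is `ρ.Space 𝕜 𝕜`. -/
def Space : Type _ := ↥(ρ.submodule 𝕜 X)

namespace Space

instance : AddCommGroup (ρ.Space 𝕜 X) :=
  inferInstanceAs (AddCommGroup ↥(ρ.submodule 𝕜 X))

instance : Module 𝕜 (ρ.Space 𝕜 X) :=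
  inferInstanceAs (Module 𝕜 ↥(ρ.submodule 𝕜 X))

instance : CoeFun (ρ.Space 𝕜 X) (fun _ => ι → X) := ⟨fun f => f.1⟩

/-- The norm `‖f‖ = ρ(‖f‖_X)` of `L_ρ(X)`. -/
noncomputable instance : Norm (ρ.Space 𝕜 X) :=
  ⟨fun f => (ρ.toFun (fun i => ‖f i‖₊)).toReal⟩

theorem norm_def (f : ρ.Space 𝕜 X) : ‖f‖ = (ρ.toFun (fun i => ‖f i‖₊)).toReal := rfl

theorem core : NormedSpace.Core 𝕜 (ρ.Space 𝕜 X) where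
  norm_nonneg f := ENNReal.toReal_nonneg
  norm_smul c f := by
    have h : (fun i => ‖(c • f : ρ.Space 𝕜 X) i‖₊) = ‖c‖₊ • (fun i => ‖f i‖₊) := by
      ext i
      change ((‖c • f i‖₊ : ℝ≥0) : ℝ) = _
      simp [nnnorm_smul]
    rw [norm_def, norm_def, h, ρ.smul', ENNReal.toReal_mul]
    simp
  norm_triangle f g := by
    rw [norm_def, norm_def, norm_def, ← ENNReal.toReal_add f.2.ne g.2.ne]
    refine ENNReal.toReal_mono (ENNReal.add_lt_top.2 ⟨f.2, g.2⟩).ne ?_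
    exact (ρ.mono' _ _ (fun i => nnnorm_add_le (f i) (g i))).trans (ρ.add_le' _ _)
  norm_eq_zero_iff f := by
    rw [norm_def, ENNReal.toReal_eq_zero_iff, or_iff_left f.2.ne, ρ.eq_zero_iff']
    constructor
    · intro h
      refine Subtype.ext (funext fun i => ?_)
      exact nnnorm_eq_zero.1 (congrFun h i)
    · rintro rfl
      ext i
      change ((‖(0 : X)‖₊ : ℝ≥0) : ℝ) = 0
      simp

noncomputable instance : NormedAddCommGroup (ρ.Space 𝕜 X) :=
  NormedAddCommGroup.ofCore (core ρ 𝕜 X)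

noncomputable instance : NormedSpace 𝕜 (ρ.Space 𝕜 X) :=
  NormedSpace.ofCore (core ρ 𝕜 X)

end Space

end VectorValued

/-- The absolute value (lattice modulus) `|f|` in the scalar-valued function space `L_ρ`. -/
def abs (ρ : FunctionNorm ι) (𝕜 : Type*) [RCLike 𝕜] (f : ρ.Space 𝕜 𝕜) : ρ.Space 𝕜 𝕜 :=
  ⟨fun i => ((‖f i‖ : ℝ) : 𝕜), by
    have h : (fun i => ‖((‖f i‖ : ℝ) : 𝕜)‖₊) = fun i => ‖f i‖₊ := by
      ext i; simp
    change ρ.toFun _ < ∞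
    rw [h]
    exact f.2⟩

/-- The Banach lattice `L_ρ` is lattice isomorphic to `ℓ_p(ι)`: there is a linear homeomorphism
`T` with `T|f| = |T f|` for all `f`, where the lattice operations are the coordinatewise ones. -/
def LatticeIsoLp (ρ : FunctionNorm ι) (𝕜 : Type*) [RCLike 𝕜] (p : ℝ≥0∞) [Fact (1 ≤ p)] : Prop :=
  ∃ T : ρ.Space 𝕜 𝕜 ≃L[𝕜] lp (fun _ : ι => 𝕜) p,
    ∀ (f : ρ.Space 𝕜 𝕜) (i : ι), T (ρ.abs 𝕜 f) i = ((‖T f i‖ : ℝ) : 𝕜)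

end FunctionNorm

/-- `X` isomorphically embeds in `Y`: there is a bounded linear map that is bounded below. -/
def IsomorphicallyEmbeds (𝕜 X Y : Type*) [RCLike 𝕜] [NormedAddCommGroup X] [NormedSpace 𝕜 X]
    [NormedAddCommGroup Y] [NormedSpace 𝕜 Y] : Prop :=
  ∃ J : X →L[𝕜] Y, ∃ c : ℝ, 0 < c ∧ ∀ x, c * ‖x‖ ≤ ‖J x‖

/-- The mixed-norm Lebesgue space `L_s(L_r)`: the `L_r`-valued `L_s`-space on `[0, 1]` with
Lebesgue measure, where `L_r` is the scalar-valued space on `[0, 1]` with Lebesgue measure. -/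
abbrev MixedLp (𝕜 : Type*) [RCLike 𝕜] (s r : ℝ≥0∞) [Fact (1 ≤ r)] : Type _ :=
  Lp (Lp 𝕜 r (volume : Measure unitInterval)) s (volume : Measure unitInterval)

/-! The unit vectors `e_n` of `ℓ_p` are sent by an embedding to vectors that become negligible in a
weak sense, and in a mixed-norm space negligible perturbations behave as if they were disjoint.
Negligibility is measured by a functional `w` on `L_s(L_r)`: either the `L₁`-mean of the scalar
modulus over both variables, or the `L₁`-mean of the `L_r`-norm.

Khintchine's inequality gives `w` a cotype-like bound (`HasSignBound`) with `q = 2` for the first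
choice and `q = max(r, 2)` for the second. If `q < p`, then `w(J e_n) → 0`: otherwise `m` images
with `w ≥ δ` would have signed sums of average size at least a multiple of `m^(1/q)`, against the
upper bound `‖J‖ m^(1/p)` (`HasSignBound.tendsto_map_single`).

If `w(y_n) → 0`, then `‖x + y_n‖^t ≤ ‖x‖^t + (2‖y_n‖)^t + o(1)`, with `t = min(r, s)` for the first
`w` and `t = s` for the second, where a matching lower estimate also holds. Unit vectors chosen one
at a time keep the errors under control. Taking `m` of them in one coordinate compares `m` with
`m^(t/p)`: the upper estimate forces `t ≤ p`, the lower one `p ≤ t`. Hence `min(r, s) ≤ p` always,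
and `p = s` if `r < p`.

In the latter case, one vector `f_k e_{n_k}` in each coordinate `k` has total norm `λ(|f|)`, so the
two estimates make `λ` equivalent to the `ℓ_s`-norm on finitely supported functions. The Fatou
property extends this to all of `U`. -/

/-! ### Sign averages and Khintchine's inequality -/

section Signs

variable {ι E F : Type*} [DecidableEq ι]

/-- The signed sum `∑ i ∈ A, ε i • x i`, where `ε` is `1` on `B` and `-1` off `B`. -/
def signSum [AddCommGroup E] (A B : Finset ι) (x : ι → E) : E :=
  ∑ i ∈ A, if i ∈ B then x i else -x i

theorem map_signSum [AddCommGroup E] [AddCommGroup F] (φ : E →+ F) (A B : Finset ι) (x : ι → E) :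
    φ (signSum A B x) = signSum A B (fun i => φ (x i)) := by
  simp only [signSum, map_sum]
  refine Finset.sum_congr rfl fun i _ => ?_
  split_ifs <;> simp

theorem signSum_insert_insert [AddCommGroup E] {A B : Finset ι} {a : ι} (ha : a ∉ A)
    (x : ι → E) : signSum (insert a A) (insert a B) x = x a + signSum A B x := by
  rw [signSum, Finset.sum_insert ha, if_pos (Finset.mem_insert_self _ _), signSum]
  congr 1
  refine Finset.sum_congr rfl fun i hi => ?_
  have : i ≠ a := fun h => ha (h ▸ hi)
  simp [this]

theorem signSum_insert [AddCommGroup E] {A B : Finset ι} {a : ι} (ha : a ∉ A)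
    (hB : B ⊆ A) (x : ι → E) : signSum (insert a A) B x = -x a + signSum A B x := by
  rw [signSum, Finset.sum_insert ha, if_neg (fun h => ha (hB h)), signSum]

theorem sum_powerset_insert_signSum [AddCommGroup E] {A : Finset ι} {a : ι} (ha : a ∉ A)
    (x : ι → E) (φ : E → ℝ) :
    ∑ B ∈ (insert a A).powerset, φ (signSum (insert a A) B x) =
      ∑ B ∈ A.powerset, (φ (x a + signSum A B x) + φ (-x a + signSum A B x)) := by
  rw [Finset.sum_powerset_insert ha, ← Finset.sum_add_distrib]
  refine Finset.sum_congr rfl fun B hB => ?_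
  rw [signSum_insert_insert ha, signSum_insert ha (Finset.mem_powerset.1 hB), add_comm]

theorem sum_signSum_sq (A : Finset ι) (x : ι → ℝ) :
    ∑ B ∈ A.powerset, signSum A B x ^ 2 = 2 ^ A.card * ∑ i ∈ A, x i ^ 2 := by
  induction A using Finset.induction_on with
  | empty => simp [signSum]
  | insert a A ha ih =>
    rw [sum_powerset_insert_signSum ha x (fun y => y ^ 2), Finset.sum_insert ha,
      Finset.card_insert_of_notMem ha]
    have : ∀ B, (x a + signSum A B x) ^ 2 + (-x a + signSum A B x) ^ 2 =
        2 * x a ^ 2 + 2 * signSum A B x ^ 2 := fun B => by ring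
    simp only [this, Finset.sum_add_distrib, ← Finset.mul_sum, ih, Finset.sum_const,
      Finset.card_powerset, nsmul_eq_mul]
    push_cast
    ring

/-- Pairing the two signs of the newest term cancels the odd powers; the induction then closes
because `y² + 6yS + 3S² ≤ 3(y + S)²` for `y = x_a²` and `S` the sum of the earlier squares. -/
theorem sum_signSum_four_le (A : Finset ι) (x : ι → ℝ) :
    ∑ B ∈ A.powerset, signSum A B x ^ 4 ≤ 3 * 2 ^ A.card * (∑ i ∈ A, x i ^ 2) ^ 2 := by
  induction A using Finset.induction_on with
  | empty => simp [signSum]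
  | insert a A ha ih =>
    rw [sum_powerset_insert_signSum ha x (fun y => y ^ 4), Finset.sum_insert ha,
      Finset.card_insert_of_notMem ha]
    have : ∀ B, (x a + signSum A B x) ^ 4 + (-x a + signSum A B x) ^ 4 =
        2 * x a ^ 4 + 12 * x a ^ 2 * signSum A B x ^ 2 + 2 * signSum A B x ^ 4 :=
      fun B => by ring
    simp only [this, Finset.sum_add_distrib, ← Finset.mul_sum, sum_signSum_sq, Finset.sum_const,
      Finset.card_powerset, nsmul_eq_mul]
    push_cast
    have h2 : (0 : ℝ) ≤ 2 ^ A.card * x a ^ 4 := by positivity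
    have h3 : (2 : ℝ) ^ (A.card + 1) = 2 * 2 ^ A.card := by ring
    rw [h3]
    nlinarith

/-- Khintchine's inequality in `L₁`, for real scalars. -/
theorem khintchine_real (A : Finset ι) (x : ι → ℝ) :
    2 ^ A.card * √(∑ i ∈ A, x i ^ 2) ≤ 2 * ∑ B ∈ A.powerset, |signSum A B x| := by
  set σ := √(∑ i ∈ A, x i ^ 2) with hσ
  have hσ2 : σ ^ 2 = ∑ i ∈ A, x i ^ 2 := Real.sq_sqrt (Finset.sum_nonneg fun i _ => sq_nonneg _)
  have hσ0 : 0 ≤ σ := Real.sqrt_nonneg _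
  rcases hσ0.eq_or_lt with h0 | h0
  · rw [← h0]
    simpa using Finset.sum_nonneg fun (B : Finset ι) _ => abs_nonneg (signSum A B x)
  -- With second moment `σ²` and fourth moment at most `3σ⁴`, averaging this gives `6σ⁴ - 3σ⁴ ≤ 6σ³
  -- E|u|`, that is `E|u| ≥ σ/2`. The hints use `(u + 2a)(u - a)² = u³ - 3a²u + 2a³` at `a = 7σ/5`
  -- and `a = 3σ/2`, which enclose the critical point `√2 σ`.
  have key : ∀ u : ℝ, 0 ≤ u → 6 * σ ^ 2 * u ^ 2 - u ^ 4 ≤ 6 * σ ^ 3 * u := by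
    intro u hu
    have : 6 * σ ^ 2 * u - u ^ 3 ≤ 6 * σ ^ 3 := by
      nlinarith [mul_nonneg (by positivity : 0 ≤ u + 2 * σ) (sq_nonneg (u - σ)), pow_pos h0 3,
        mul_nonneg (by positivity : 0 ≤ u + 2 * (3/2 * σ)) (sq_nonneg (u - 3/2 * σ)),
        mul_nonneg (by positivity : 0 ≤ u + 2 * (7/5 * σ)) (sq_nonneg (u - 7/5 * σ))]
    nlinarith
  have hsum : ∑ B ∈ A.powerset, (6 * σ ^ 2 * signSum A B x ^ 2 - signSum A B x ^ 4) ≤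
      ∑ B ∈ A.powerset, 6 * σ ^ 3 * |signSum A B x| := by
    refine Finset.sum_le_sum fun B _ => ?_
    have := key |signSum A B x| (abs_nonneg _)
    have h4 : |signSum A B x| ^ 4 = signSum A B x ^ 4 := Even.pow_abs ⟨2, rfl⟩ _
    rwa [sq_abs, h4] at this
  rw [Finset.sum_sub_distrib, ← Finset.mul_sum, ← Finset.mul_sum, sum_signSum_sq, ← hσ2] at hsum
  have h4 := sum_signSum_four_le A x
  rw [← hσ2] at h4
  have h3 : 3 * σ ^ 3 * (2 ^ A.card * σ) ≤
      3 * σ ^ 3 * (2 * ∑ B ∈ A.powerset, |signSum A B x|) := by nlinarith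
  exact le_of_mul_le_mul_left h3 (by positivity)

/-- Khintchine's inequality in `L₁`, for real or complex scalars. -/
theorem khintchine {𝕜 : Type*} [RCLike 𝕜] (A : Finset ι) (x : ι → 𝕜) :
    2 ^ A.card * √(∑ i ∈ A, ‖x i‖ ^ 2) ≤ 4 * ∑ B ∈ A.powerset, ‖signSum A B x‖ := by
  have hre : ∑ B ∈ A.powerset, |signSum A B (fun i => RCLike.re (x i))| ≤
      ∑ B ∈ A.powerset, ‖signSum A B x‖ := by
    refine Finset.sum_le_sum fun B _ => ?_
    rw [← map_signSum (RCLike.re : 𝕜 →+ ℝ)]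
    exact RCLike.abs_re_le_norm _
  have him : ∑ B ∈ A.powerset, |signSum A B (fun i => RCLike.im (x i))| ≤
      ∑ B ∈ A.powerset, ‖signSum A B x‖ := by
    refine Finset.sum_le_sum fun B _ => ?_
    rw [← map_signSum (RCLike.im : 𝕜 →+ ℝ)]
    exact RCLike.abs_im_le_norm _
  have h1 := khintchine_real A (fun i => RCLike.re (x i))
  have h2 := khintchine_real A (fun i => RCLike.im (x i))
  have hsq : √(∑ i ∈ A, ‖x i‖ ^ 2) ≤
      √(∑ i ∈ A, RCLike.re (x i) ^ 2) + √(∑ i ∈ A, RCLike.im (x i) ^ 2) := by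
    have : ∑ i ∈ A, ‖x i‖ ^ 2 =
        ∑ i ∈ A, RCLike.re (x i) ^ 2 + ∑ i ∈ A, RCLike.im (x i) ^ 2 := by
      rw [← Finset.sum_add_distrib]
      refine Finset.sum_congr rfl fun i _ => ?_
      rw [RCLike.norm_sq_eq_def]
      ring
    rw [this]
    have h3 := Real.sq_sqrt (Finset.sum_nonneg fun i (_ : i ∈ A) => sq_nonneg (RCLike.re (x i)))
    have h4 := Real.sq_sqrt (Finset.sum_nonneg fun i (_ : i ∈ A) => sq_nonneg (RCLike.im (x i)))
    refine Real.sqrt_le_iff.2 ⟨by positivity, ?_⟩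
    rw [add_sq, h3, h4]
    have : 0 ≤ 2 * √(∑ i ∈ A, RCLike.re (x i) ^ 2) * √(∑ i ∈ A, RCLike.im (x i) ^ 2) := by
      positivity
    linarith
  have : (2 : ℝ) ^ A.card * √(∑ i ∈ A, ‖x i‖ ^ 2) ≤ 2 ^ A.card *
      (√(∑ i ∈ A, RCLike.re (x i) ^ 2) + √(∑ i ∈ A, RCLike.im (x i) ^ 2)) := by gcongr
  linarith

end Signs

/-! ### Weak norms and their means over a probability space -/

section WeakNorm

variable {E : Type*} [NormedAddCommGroup E]

/-- A nonnegative function that vanishes at zero and is Lipschitz with constant one. -/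
structure IsWeakNorm (w : E → ℝ) : Prop where
  nonneg : ∀ x, 0 ≤ w x
  map_zero : w 0 = 0
  abs_sub_le : ∀ x y, |w x - w y| ≤ ‖x - y‖

theorem isWeakNorm_norm : IsWeakNorm (fun x : E => ‖x‖) :=
  ⟨norm_nonneg, norm_zero, abs_norm_sub_norm_le⟩

theorem IsWeakNorm.le_norm {w : E → ℝ} (hw : IsWeakNorm w) (x : E) : w x ≤ ‖x‖ := by
  simpa [hw.map_zero] using (le_abs_self _).trans (hw.abs_sub_le x 0)

theorem IsWeakNorm.continuous {w : E → ℝ} (hw : IsWeakNorm w) : Continuous w := by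
  refine (LipschitzWith.of_dist_le_mul (K := 1) fun x y => ?_).continuous
  simpa [Real.dist_eq, dist_eq_norm] using hw.abs_sub_le x y

variable {Ω : Type*} [MeasurableSpace Ω] {μ : Measure Ω} {s : ℝ≥0∞}

/-- The `L₁`-mean of a function `w` on `E`, as a function on `L_s(E)`. -/
noncomputable def lpMean (w : E → ℝ) (f : Lp E s μ) : ℝ := ∫ τ, w (f τ) ∂μ

theorem Lp.integrable_norm [IsFiniteMeasure μ] (hs : 1 ≤ s) (f : Lp E s μ) :
    Integrable (fun τ => ‖f τ‖) μ :=
  ((Lp.memLp f).integrable hs).norm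

theorem IsWeakNorm.integrable {w : E → ℝ} (hw : IsWeakNorm w) [IsFiniteMeasure μ] (hs : 1 ≤ s)
    (f : Lp E s μ) : Integrable (fun τ => w (f τ)) μ := by
  refine (Lp.integrable_norm hs f).mono'
    (hw.continuous.comp_aestronglyMeasurable (Lp.aestronglyMeasurable f)) ?_
  filter_upwards with τ
  rw [Real.norm_of_nonneg (hw.nonneg _)]
  exact hw.le_norm _

theorem Lp.integral_norm_le_norm [IsProbabilityMeasure μ] (hs : 1 ≤ s) (f : Lp E s μ) :
    ∫ τ, ‖f τ‖ ∂μ ≤ ‖f‖ := by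
  rw [integral_norm_eq_lintegral_enorm (Lp.aestronglyMeasurable f),
    ← eLpNorm_one_eq_lintegral_enorm, Lp.norm_def]
  exact ENNReal.toReal_mono (Lp.eLpNorm_ne_top f)
    (eLpNorm_le_eLpNorm_of_exponent_le hs (Lp.aestronglyMeasurable f))

/-- On a probability space the `L₁`-norm is at most the `L_s`-norm, so the Lipschitz constant stays
one and the construction can be iterated over both variables. -/
theorem IsWeakNorm.lpMean {w : E → ℝ} (hw : IsWeakNorm w) [IsProbabilityMeasure μ]
    [Fact (1 ≤ s)] : IsWeakNorm (lpMean w : Lp E s μ → ℝ) where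
  nonneg f := integral_nonneg fun τ => hw.nonneg (f τ)
  map_zero := by
    refine integral_eq_zero_of_ae ?_
    filter_upwards [Lp.coeFn_zero E s μ] with τ hτ
    rw [hτ]
    exact hw.map_zero
  abs_sub_le f g := by
    have hs : 1 ≤ s := Fact.out
    unfold _root_.lpMean
    rw [← integral_sub (hw.integrable hs f) (hw.integrable hs g)]
    refine (abs_integral_le_integral_abs).trans (le_trans ?_ (Lp.integral_norm_le_norm hs (f - g)))
    refine integral_mono_ae ((hw.integrable hs f).sub (hw.integrable hs g)).abs
      (Lp.integrable_norm hs _) ?_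
    filter_upwards [Lp.coeFn_sub f g] with τ hτ
    rw [hτ]
    exact hw.abs_sub_le (f τ) (g τ)

theorem IsWeakNorm.exists_subseq_ae_tendsto {w : E → ℝ} (hw : IsWeakNorm w) [IsFiniteMeasure μ]
    (hs : 1 ≤ s) {b : ℕ → Lp E s μ}
    (hb : Tendsto (fun n => _root_.lpMean w (b n)) atTop (𝓝 0)) :
    ∃ φ : ℕ → ℕ, StrictMono φ ∧
      ∀ᵐ τ ∂μ, Tendsto (fun n => w (b (φ n) τ)) atTop (𝓝 0) := by
  have h : TendstoInMeasure μ (fun n τ => w (b n τ)) atTop (fun _ => (0 : ℝ)) := by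
    refine tendstoInMeasure_of_tendsto_eLpNorm one_ne_zero
      (fun n => (hw.integrable hs (b n)).aestronglyMeasurable) aestronglyMeasurable_const ?_
    have h1 : ∀ n, eLpNorm ((fun τ => w (b n τ)) - fun _ => (0 : ℝ)) 1 μ =
        ENNReal.ofReal (_root_.lpMean w (b n)) := by
      intro n
      rw [eLpNorm_one_eq_lintegral_enorm, _root_.lpMean,
        ofReal_integral_eq_lintegral_ofReal (hw.integrable hs (b n))
          (Eventually.of_forall fun τ => hw.nonneg _)]
      refine lintegral_congr fun τ => ?_
      simp [Real.enorm_of_nonneg (hw.nonneg _)]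
    simp only [h1]
    simpa [Function.comp_def] using (ENNReal.continuous_ofReal.tendsto 0).comp hb
  exact h.exists_seq_tendsto_ae

theorem Lp.norm_rpow_eq_integral (hs : s ≠ 0) (hs' : s ≠ ∞) (f : Lp E s μ) :
    ‖f‖ ^ s.toReal = ∫ τ, ‖f τ‖ ^ s.toReal ∂μ := by
  have h0 : 0 ≤ ∫ τ, ‖f τ‖ ^ s.toReal ∂μ := integral_nonneg fun τ => by positivity
  rw [Lp.norm_def, (Lp.memLp f).eLpNorm_eq_integral_rpow_norm hs hs',
    ENNReal.toReal_ofReal (by positivity), ← Real.rpow_mul h0,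
    inv_mul_cancel₀ (ENNReal.toReal_pos hs hs').ne', Real.rpow_one]

end WeakNorm

/-! ### Weak cotype of scalars, of `L_r`, and of means -/

section SignBound

variable {E : Type*} [NormedAddCommGroup E] {Ω : Type*} [MeasurableSpace Ω] {μ : Measure Ω}
  {s : ℝ≥0∞}

/-- A weak form of cotype `q`, with respect to a functional `w` on `E`. -/
def HasSignBound (w : E → ℝ) (q : ℝ) : Prop :=
  ∃ c : ℝ, 0 < c ∧ ∀ (A : Finset ℕ) (x : ℕ → E),
    c * 2 ^ A.card * (A.card : ℝ) ^ (1 / q - 1) * ∑ i ∈ A, w (x i) ≤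
      ∑ B ∈ A.powerset, w (signSum A B x)

theorem Lp.coeFn_signSum {ι : Type*} [DecidableEq ι] (A B : Finset ι) (f : ι → Lp E s μ) :
    ⇑(signSum A B f) =ᵐ[μ] fun τ => signSum A B (fun i => f i τ) := by
  have h : ∀ᵐ τ ∂μ, ∀ i ∈ A, (-f i : Lp E s μ) τ = -(f i τ) := by
    rw [Finset.eventually_all]
    exact fun i _ => Lp.coeFn_neg (f i)
  filter_upwards [Lp.coeFn_fun_finsetSum A (fun i => if i ∈ B then f i else -f i), h] with τ h1 h2
  rw [signSum, h1, signSum]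
  refine Finset.sum_congr rfl fun i hi => ?_
  split_ifs
  · rfl
  · exact h2 i hi

/-- The bound is linear in `w`, so it integrates pointwise. Both the constant and `q` are therefore
independent of `s`. -/
theorem HasSignBound.lpMean {w : E → ℝ} (hw : IsWeakNorm w) {q : ℝ} (h : HasSignBound w q)
    [IsProbabilityMeasure μ] [Fact (1 ≤ s)] : HasSignBound (lpMean w : Lp E s μ → ℝ) q := by
  have hs : 1 ≤ s := Fact.out
  obtain ⟨c, hc, h⟩ := h
  refine ⟨c, hc, fun A x => ?_⟩
  unfold _root_.lpMean
  rw [← integral_finsetSum _ fun i _ => hw.integrable hs _,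
    ← integral_finsetSum _ fun i _ => hw.integrable hs _, ← integral_const_mul]
  refine integral_mono_ae ((integrable_finsetSum _ fun i _ => hw.integrable hs _).const_mul _)
    (integrable_finsetSum _ fun i _ => hw.integrable hs _) ?_
  have h1 : ∀ᵐ τ ∂μ, ∀ B ∈ A.powerset,
      (signSum A B x : Lp E s μ) τ = signSum A B (fun i => x i τ) := by
    rw [Finset.eventually_all]
    exact fun B _ => Lp.coeFn_signSum A B x
  filter_upwards [h1] with τ hτ
  rw [Finset.sum_congr rfl fun B hB => congrArg w (hτ B hB)]
  exact h A fun i => x i τ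

/-- For `R ≥ 2` the factor is one and `a_i^R ≤ a_i² σ^(R-2)`. For `R ≤ 2` the power mean inequality
with exponent `2/R` costs the factor `N^(R/2-1)`. -/
theorem sum_rpow_mul_card_rpow_le (A : Finset ℕ) (hA : A.Nonempty) (a : ℕ → ℝ)
    (ha : ∀ i, 0 ≤ a i) {R : ℝ} (hR : 1 ≤ R) :
    (A.card : ℝ) ^ (R / max R 2 - 1) * ∑ i ∈ A, a i ^ R ≤ √(∑ i ∈ A, a i ^ 2) ^ R := by
  have hN : (0 : ℝ) < A.card := by exact_mod_cast hA.card_pos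
  set σ := √(∑ i ∈ A, a i ^ 2) with hσ
  have hσ0 : 0 ≤ σ := Real.sqrt_nonneg _
  have hσ2 : σ ^ 2 = ∑ i ∈ A, a i ^ 2 := Real.sq_sqrt (Finset.sum_nonneg fun i _ => sq_nonneg _)
  have split : ∀ u : ℝ, 0 ≤ u → u ^ R = u ^ 2 * u ^ (R - 2) := by
    intro u hu
    rw [← Real.rpow_natCast u 2, ← Real.rpow_add' hu] <;> norm_num
    linarith
  rcases le_total 2 R with h | h
  · rw [max_eq_left h, div_self (by linarith), sub_self, Real.rpow_zero, one_mul, split σ hσ0, hσ2,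
      Finset.sum_mul]
    refine Finset.sum_le_sum fun i hi => ?_
    rw [split _ (ha i)]
    refine mul_le_mul_of_nonneg_left (Real.rpow_le_rpow (ha i) ?_ (by linarith)) (sq_nonneg _)
    exact Real.le_sqrt_of_sq_le
      (Finset.single_le_sum (f := fun i => a i ^ 2) (fun i _ => sq_nonneg _) hi)
  · rw [max_eq_right h]
    have hm := Real.rpow_arith_mean_le_arith_mean_rpow A (fun _ => (A.card : ℝ)⁻¹)
      (fun i => a i ^ R) (fun _ _ => by positivity)
      (by rw [Finset.sum_const, nsmul_eq_mul, mul_inv_cancel₀ hN.ne'])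
      (fun i _ => Real.rpow_nonneg (ha i) _) (p := 2 / R) (by rw [le_div_iff₀] <;> linarith)
    have he : ∀ i, (a i ^ R) ^ (2 / R) = a i ^ 2 := by
      intro i
      rw [← Real.rpow_mul (ha i), mul_div_cancel₀ _ (by linarith : R ≠ 0)]
      norm_num
    simp only [he, ← Finset.mul_sum, ← hσ2] at hm
    have hS : 0 ≤ ∑ i ∈ A, a i ^ R := Finset.sum_nonneg fun i _ => Real.rpow_nonneg (ha i) _
    have hm2 := Real.rpow_le_rpow (by positivity) hm (by linarith : 0 ≤ R / 2)
    rw [← Real.rpow_mul (by positivity), div_mul_div_cancel₀ (by linarith : R ≠ 0), div_self two_ne_zero,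
      Real.rpow_one, Real.mul_rpow (by positivity) (by positivity), ← Real.rpow_natCast σ 2,
      ← Real.rpow_mul hσ0] at hm2
    have e1 : ((2 : ℕ) : ℝ) * (R / 2) = R := by push_cast; ring
    rw [e1, Real.inv_rpow hN.le] at hm2
    rw [Real.rpow_sub hN, Real.rpow_one]
    have : (0 : ℝ) < (A.card : ℝ) ^ (R / 2) := by positivity
    calc _ = (A.card : ℝ) ^ (R / 2) * ((A.card : ℝ)⁻¹ * ∑ i ∈ A, a i ^ R) := by ring
      _ ≤ (A.card : ℝ) ^ (R / 2) * (((A.card : ℝ) ^ (R / 2))⁻¹ * σ ^ R) := by gcongr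
      _ = σ ^ R := by field_simp

theorem hasSignBound_scalar (𝕜 : Type*) [RCLike 𝕜] : HasSignBound (fun x : 𝕜 => ‖x‖) 2 := by
  refine ⟨1 / 4, by norm_num, fun A x => ?_⟩
  rcases A.eq_empty_or_nonempty with rfl | hA
  · simp [signSum]
  have hN : (0 : ℝ) < A.card := by exact_mod_cast hA.card_pos
  have h1 := sum_rpow_mul_card_rpow_le A hA (fun i => ‖x i‖) (fun i => norm_nonneg _) le_rfl
  norm_num at h1
  have h2 := khintchine A x
  have h3 : (1 / 2 - 1 : ℝ) = -(1 / 2) := by norm_num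
  rw [h3]
  have : (2 : ℝ) ^ A.card * ((A.card : ℝ) ^ (-(1 / 2) : ℝ) * ∑ i ∈ A, ‖x i‖) ≤
      2 ^ A.card * √(∑ i ∈ A, ‖x i‖ ^ 2) := by gcongr
  linarith

/-- The triangle inequality is applied to the moduli `|signSum A B x|`, so that Khintchine can be
used pointwise under a single `L_r`-norm. In the exponent, `R / max R 2 - 1` comes from comparing
`ℓ_2` with `ℓ_R` and `1 - R` from passing from `∑ ‖x i‖ ^ R` to `(∑ ‖x i‖) ^ R`. -/
theorem Lp.hasSignBound_norm (𝕜 : Type*) [RCLike 𝕜] {r : ℝ≥0∞} [hr1 : Fact (1 ≤ r)]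
    (hr : r ≠ ∞) : HasSignBound (fun x : Lp 𝕜 r μ => ‖x‖) (max r.toReal 2) := by
  refine ⟨1 / 4, by norm_num, fun A x => ?_⟩
  rcases A.eq_empty_or_nonempty with rfl | hA
  · simp [signSum]
  have hN : (0 : ℝ) < A.card := by exact_mod_cast hA.card_pos
  have hr0 : r ≠ 0 := (zero_lt_one.trans_le hr1.out).ne'
  set R := r.toReal with hRdef
  have hR : 1 ≤ R := by
    rw [hRdef, ← ENNReal.toReal_one]
    exact ENNReal.toReal_mono hr hr1.out
  set N : ℝ := (A.card : ℝ) with hNdef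
  let g : Finset ℕ → Lp ℝ r μ := fun B => (Lp.memLp (signSum A B x)).norm.toLp _
  have hg : ∀ B, ‖g B‖ = ‖signSum A B x‖ := fun B => by
    rw [Lp.norm_toLp, Lp.norm_def, eLpNorm_norm]
  have hG : ‖∑ B ∈ A.powerset, g B‖ ≤ ∑ B ∈ A.powerset, ‖signSum A B x‖ :=
    (norm_sum_le _ _).trans_eq (Finset.sum_congr rfl fun B _ => hg B)
  refine le_trans ?_ hG
  have hint : ∀ f : Lp 𝕜 r μ, Integrable (fun τ => ‖f τ‖ ^ R) μ := fun f =>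
    (Lp.memLp f).integrable_norm_rpow hr0 hr
  have key : (1 / 4 * 2 ^ A.card) ^ R * N ^ (R / max R 2 - 1) * ∑ i ∈ A, ‖x i‖ ^ R ≤
      ‖∑ B ∈ A.powerset, g B‖ ^ R := by
    rw [Lp.norm_rpow_eq_integral hr0 hr,
      Finset.sum_congr rfl fun i _ => Lp.norm_rpow_eq_integral hr0 hr (x i),
      ← integral_finsetSum _ fun i _ => hint (x i), ← integral_const_mul]
    refine integral_mono_ae ((integrable_finsetSum _ fun i _ => hint (x i)).const_mul _)
      ((Lp.memLp _).integrable_norm_rpow hr0 hr) ?_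
    have h1 : ∀ᵐ τ ∂μ, ∀ B ∈ A.powerset, g B τ = ‖signSum A B (fun i => x i τ)‖ := by
      rw [Finset.eventually_all]
      intro B _
      filter_upwards [Lp.coeFn_signSum A B x, (Lp.memLp (signSum A B x)).norm.coeFn_toLp]
        with τ h2 h3
      rw [h3, h2]
    filter_upwards [h1, Lp.coeFn_fun_finsetSum A.powerset g] with τ h2 h3
    rw [h3, Finset.sum_congr rfl h2, Real.norm_of_nonneg (Finset.sum_nonneg fun B _ => norm_nonneg _)]
    have h4 := khintchine A (fun i => x i τ)
    have h5 := sum_rpow_mul_card_rpow_le A hA (fun i => ‖x i τ‖) (fun i => norm_nonneg _) hR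
    calc _ ≤ (1 / 4 * 2 ^ A.card) ^ R * √(∑ i ∈ A, ‖x i τ‖ ^ 2) ^ R := by
          rw [mul_assoc]; gcongr
      _ = (1 / 4 * 2 ^ A.card * √(∑ i ∈ A, ‖x i τ‖ ^ 2)) ^ R :=
          (Real.mul_rpow (by positivity) (by positivity)).symm
      _ ≤ _ := by
          refine Real.rpow_le_rpow (by positivity) ?_ (by linarith)
          linarith
  have hpow := Real.rpow_sum_le_const_mul_sum_rpow A (fun i => ‖x i‖) hR
  simp only [abs_norm] at hpow
  refine (Real.rpow_le_rpow_iff (by positivity) (norm_nonneg _) (by linarith : 0 < R)).1 ?_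
  refine le_trans ?_ key
  rw [Real.mul_rpow (by positivity) (by positivity), Real.mul_rpow (by positivity) (by positivity),
    ← Real.rpow_mul hN.le]
  have e : (1 / max R 2 - 1) * R = (R / max R 2 - 1) + (1 - R) := by ring
  rw [e, Real.rpow_add hN, mul_assoc, mul_assoc, mul_assoc]
  have e2 : N ^ (1 - R) * (∑ i ∈ A, ‖x i‖) ^ R ≤ ∑ i ∈ A, ‖x i‖ ^ R := by
    calc _ ≤ N ^ (1 - R) * (N ^ (R - 1) * ∑ i ∈ A, ‖x i‖ ^ R) := by gcongr
      _ = ∑ i ∈ A, ‖x i‖ ^ R := by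
        rw [← mul_assoc, ← Real.rpow_add hN]; simp
  gcongr

end SignBound

/-! ### Asymptotic upper and lower estimates -/

section AsymptoticEstimates

variable {E : Type*} [NormedAddCommGroup E]

/-- The amount by which the upper `t`-estimate fails for the pair `x`, `y`. -/
noncomputable def upperDefect (t : ℝ) (x y : E) : ℝ :=
  max 0 (‖x + y‖ ^ t - ‖x‖ ^ t - (2 * ‖y‖) ^ t)

/-- The amount by which the lower `t`-estimate fails for the pair `x`, `y`. -/
noncomputable def lowerDefect (t : ℝ) (x y : E) : ℝ :=
  max 0 (‖x‖ ^ t + (‖y‖ / 2) ^ t - ‖x + y‖ ^ t)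

/-- Perturbations that are null for `w` satisfy an upper `t`-estimate asymptotically. -/
def HasUpperEstimate (w : E → ℝ) (t : ℝ) : Prop :=
  ∀ (x : E) (y : ℕ → E), Tendsto (fun n => w (y n)) atTop (𝓝 0) →
    Tendsto (fun n => upperDefect t x (y n)) atTop (𝓝 0)

/-- Perturbations that are null for `w` satisfy a lower `t`-estimate asymptotically. -/
def HasLowerEstimate (w : E → ℝ) (t : ℝ) : Prop :=
  ∀ (x : E) (y : ℕ → E), Tendsto (fun n => w (y n)) atTop (𝓝 0) →
    Tendsto (fun n => lowerDefect t x (y n)) atTop (𝓝 0)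

variable {t : ℝ}

theorem continuous_upperDefect (ht : 0 < t) :
    Continuous fun z : E × E => upperDefect t z.1 z.2 := by
  unfold upperDefect
  fun_prop (disch := exact ht.le)

theorem continuous_lowerDefect (ht : 0 < t) :
    Continuous fun z : E × E => lowerDefect t z.1 z.2 := by
  unfold lowerDefect
  fun_prop (disch := exact ht.le)

theorem upperDefect_nonneg (x y : E) : 0 ≤ upperDefect t x y := le_max_left _ _

theorem lowerDefect_nonneg (x y : E) : 0 ≤ lowerDefect t x y := le_max_left _ _

/-- The factor 2 in the definition is what makes this bound free of `y`: the defect vanishes once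
`‖x‖ ≤ ‖y‖`. This supplies the dominating function for perturbations that are small only in the weak
sense. -/
theorem upperDefect_le (ht : 0 < t) (x y : E) : upperDefect t x y ≤ (2 * ‖x‖) ^ t := by
  refine max_le (by positivity) ?_
  have h0 : 0 ≤ ‖x‖ ^ t := by positivity
  have h1 := norm_add_le x y
  rcases le_total ‖x‖ ‖y‖ with h | h
  · have : ‖x + y‖ ^ t ≤ (2 * ‖y‖) ^ t :=
      Real.rpow_le_rpow (norm_nonneg _) (by linarith) ht.le
    have : 0 ≤ (2 * ‖x‖) ^ t := by positivity
    linarith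
  · have : ‖x + y‖ ^ t ≤ (2 * ‖x‖) ^ t :=
      Real.rpow_le_rpow (norm_nonneg _) (by linarith) ht.le
    have : 0 ≤ (2 * ‖y‖) ^ t := by positivity
    linarith

/-- As for the upper defect: if `‖y‖ / 2 ≥ ‖x‖`, then `‖x + y‖ ≥ ‖y‖ / 2`, so no bound on `y` is
needed. -/
theorem lowerDefect_le (ht : 0 < t) (x y : E) : lowerDefect t x y ≤ 2 * ‖x‖ ^ t := by
  refine max_le (by positivity) ?_
  have h0 : 0 ≤ ‖x‖ ^ t := by positivity
  have h1 : ‖y‖ ≤ ‖x + y‖ + ‖x‖ := by simpa using norm_sub_le (x + y) x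
  rcases le_total (‖y‖ / 2) ‖x‖ with h | h
  · have : (‖y‖ / 2) ^ t ≤ ‖x‖ ^ t := Real.rpow_le_rpow (by positivity) h ht.le
    have : 0 ≤ ‖x + y‖ ^ t := by positivity
    linarith
  · have : (‖y‖ / 2) ^ t ≤ ‖x + y‖ ^ t := Real.rpow_le_rpow (by positivity) (by linarith) ht.le
    linarith

/-- The base case, immediate by continuity; the content enters when `w` is replaced by its mean. -/
theorem hasUpperEstimate_norm (ht : 0 < t) : HasUpperEstimate (fun x : E => ‖x‖) t := by
  intro x y hy
  have hy' : Tendsto y atTop (𝓝 0) := tendsto_zero_iff_norm_tendsto_zero.2 hy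
  have := ((continuous_upperDefect (E := E) ht).tendsto (x, 0)).comp
    ((tendsto_const_nhds (x := x)).prodMk_nhds hy')
  simpa [upperDefect, ht.ne', Function.comp_def] using this

theorem hasLowerEstimate_norm (ht : 0 < t) : HasLowerEstimate (fun x : E => ‖x‖) t := by
  intro x y hy
  have hy' : Tendsto y atTop (𝓝 0) := tendsto_zero_iff_norm_tendsto_zero.2 hy
  have := ((continuous_lowerDefect (E := E) ht).tendsto (x, 0)).comp
    ((tendsto_const_nhds (x := x)).prodMk_nhds hy')
  simpa [lowerDefect, ht.ne', Function.comp_def] using this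

variable {Ω : Type*} [MeasurableSpace Ω] {μ : Measure Ω} {s : ℝ≥0∞}

theorem AEStronglyMeasurable.upperDefect (ht : 0 < t) {f g : Ω → E}
    (hf : AEStronglyMeasurable f μ) (hg : AEStronglyMeasurable g μ) :
    AEStronglyMeasurable (fun τ => _root_.upperDefect t (f τ) (g τ)) μ :=
  Continuous.comp_aestronglyMeasurable (g := fun z : E × E => _root_.upperDefect t z.1 z.2)
    (f := fun τ => (f τ, g τ)) (continuous_upperDefect ht) (hf.prodMk hg)

theorem AEStronglyMeasurable.lowerDefect (ht : 0 < t) {f g : Ω → E}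
    (hf : AEStronglyMeasurable f μ) (hg : AEStronglyMeasurable g μ) :
    AEStronglyMeasurable (fun τ => _root_.lowerDefect t (f τ) (g τ)) μ :=
  Continuous.comp_aestronglyMeasurable (g := fun z : E × E => _root_.lowerDefect t z.1 z.2)
    (f := fun τ => (f τ, g τ)) (continuous_lowerDefect ht) (hf.prodMk hg)

/-- Minkowski's inequality in `L_{s/t}` for the `t`-th powers of the pointwise norms, which is where
`t ≤ s` enters. -/
theorem Lp.norm_add_rpow_le [Fact (1 ≤ s)] (ht : 0 < t) (hts : ENNReal.ofReal t ≤ s)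
    (f g : Lp E s μ) :
    ‖f + g‖ ^ t ≤ ‖f‖ ^ t + (2 * ‖g‖) ^ t +
      (eLpNorm (fun τ => upperDefect t (f τ) (g τ)) (s / ENNReal.ofReal t) μ).toReal := by
  set u := s / ENNReal.ofReal t with hu
  have ht' : ENNReal.ofReal t ≠ 0 := (ENNReal.ofReal_pos.2 ht).ne'
  have hut : u * ENNReal.ofReal t = s := ENNReal.div_mul_cancel ht' ENNReal.ofReal_ne_top
  have hu1 : 1 ≤ u := by
    rw [hu, ENNReal.le_div_iff_mul_le (Or.inl ht') (Or.inl ENNReal.ofReal_ne_top), one_mul]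
    exact hts
  have hrpow : ∀ h : Lp E s μ, eLpNorm (fun τ => ‖h τ‖ ^ t) u μ = eLpNorm h s μ ^ t := fun h => by
    rw [eLpNorm_norm_rpow _ ht, hut]
  have hmeas : ∀ h : Lp E s μ, AEStronglyMeasurable (fun τ => ‖h τ‖ ^ t) μ := fun h =>
    (((Lp.aestronglyMeasurable h).norm.aemeasurable).pow_const t).aestronglyMeasurable
  have hD : AEStronglyMeasurable (fun τ => upperDefect t (f τ) (g τ)) μ :=
    AEStronglyMeasurable.upperDefect ht (Lp.aestronglyMeasurable f) (Lp.aestronglyMeasurable g)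
  have hDfin : eLpNorm (fun τ => upperDefect t (f τ) (g τ)) u μ ≠ ∞ := by
    have : eLpNorm (fun τ => upperDefect t (f τ) (g τ)) u μ ≤
        eLpNorm ((2 : ℝ) ^ t • fun τ => ‖f τ‖ ^ t) u μ := by
      refine eLpNorm_mono_real fun τ => ?_
      rw [Real.norm_of_nonneg (upperDefect_nonneg _ _)]
      refine (upperDefect_le ht _ _).trans_eq ?_
      rw [Real.mul_rpow zero_le_two (norm_nonneg _)]
      rfl
    refine (this.trans_lt ?_).ne
    rw [eLpNorm_const_smul, hrpow]
    exact ENNReal.mul_lt_top enorm_lt_top (ENNReal.rpow_lt_top_of_nonneg ht.le (Lp.eLpNorm_ne_top f))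
  have key : eLpNorm (f + g : Lp E s μ) s μ ^ t ≤ eLpNorm f s μ ^ t +
      ENNReal.ofReal (2 ^ t) * eLpNorm g s μ ^ t +
        eLpNorm (fun τ => upperDefect t (f τ) (g τ)) u μ := by
    calc eLpNorm (f + g : Lp E s μ) s μ ^ t = eLpNorm (fun τ => ‖(f + g : Lp E s μ) τ‖ ^ t) u μ :=
          (hrpow _).symm
      _ ≤ eLpNorm (((fun τ => ‖f τ‖ ^ t) + (2 : ℝ) ^ t • fun τ => ‖g τ‖ ^ t) +
            fun τ => upperDefect t (f τ) (g τ)) u μ := by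
          refine eLpNorm_mono_ae_real ?_
          filter_upwards [Lp.coeFn_add f g] with τ hτ
          rw [hτ, Real.norm_of_nonneg (by positivity)]
          simp only [Pi.add_apply, Pi.smul_apply, smul_eq_mul]
          rw [← Real.mul_rpow zero_le_two (norm_nonneg _)]
          have := le_max_right 0 (‖f τ + g τ‖ ^ t - ‖f τ‖ ^ t - (2 * ‖g τ‖) ^ t)
          unfold upperDefect
          linarith
      _ ≤ _ := by
          refine (eLpNorm_add_le ((hmeas f).add ((hmeas g).const_smul _)) hD hu1).trans ?_
          gcongr
          refine (eLpNorm_add_le (hmeas f) ((hmeas g).const_smul _) hu1).trans ?_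
          rw [eLpNorm_const_smul, hrpow, hrpow, Real.enorm_of_nonneg (by positivity)]
  have hf : eLpNorm f s μ ^ t ≠ ∞ :=
    (ENNReal.rpow_lt_top_of_nonneg ht.le (Lp.eLpNorm_ne_top f)).ne
  have hg : ENNReal.ofReal (2 ^ t) * eLpNorm g s μ ^ t ≠ ∞ :=
    (ENNReal.mul_lt_top ENNReal.ofReal_lt_top
      (ENNReal.rpow_lt_top_of_nonneg ht.le (Lp.eLpNorm_ne_top g))).ne
  have := ENNReal.toReal_mono (ENNReal.add_ne_top.2 ⟨ENNReal.add_ne_top.2 ⟨hf, hg⟩, hDfin⟩) key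
  rw [ENNReal.toReal_add (ENNReal.add_ne_top.2 ⟨hf, hg⟩) hDfin, ENNReal.toReal_add hf hg,
    ENNReal.toReal_mul, ENNReal.toReal_ofReal (by positivity), ← ENNReal.toReal_rpow,
    ← ENNReal.toReal_rpow, ← ENNReal.toReal_rpow] at this
  rw [Real.mul_rpow zero_le_two (norm_nonneg _)]
  exact this

/-- Along a subsequence `w` tends to zero almost everywhere, so the pointwise defects do too. They
are dominated by `(2‖f‖)^t`, hence tend to zero in `L_{s/t}`, and this norm controls the defect in
`L_s`. -/
theorem HasUpperEstimate.lpMean {w : E → ℝ} (hw : IsWeakNorm w) (h : HasUpperEstimate w t)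
    [IsProbabilityMeasure μ] [Fact (1 ≤ s)] (hs : s ≠ ∞) (ht : 0 < t)
    (hts : ENNReal.ofReal t ≤ s) : HasUpperEstimate (lpMean w : Lp E s μ → ℝ) t := by
  intro f g hg
  refine tendsto_of_subseq_tendsto fun ns hns => ?_
  obtain ⟨φ, -, hφ⟩ := hw.exists_subseq_ae_tendsto Fact.out (hg.comp hns)
  refine ⟨φ, ?_⟩
  set b : ℕ → Lp E s μ := fun n => g (ns (φ n)) with hb
  set u := s / ENNReal.ofReal t with hu
  have ht' : ENNReal.ofReal t ≠ 0 := (ENNReal.ofReal_pos.2 ht).ne'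
  have hs0 : s ≠ 0 := (zero_lt_one.trans_le (Fact.out : 1 ≤ s)).ne'
  have hu0 : u ≠ 0 := (ENNReal.div_pos hs0 ENNReal.ofReal_ne_top).ne'
  have hut : u ≠ ∞ := (ENNReal.div_lt_top hs ht').ne
  have htu : t * u.toReal = s.toReal := by
    rw [hu, ENNReal.toReal_div, ENNReal.toReal_ofReal ht.le, mul_div_cancel₀ _ ht.ne']
  have hu' : 0 < u.toReal := ENNReal.toReal_pos hu0 hut
  have hD : Tendsto (fun n => eLpNorm (fun τ => upperDefect t (f τ) (b n τ)) u μ) atTop (𝓝 0) := by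
    simp only [eLpNorm_eq_lintegral_rpow_enorm_toReal hu0 hut]
    have h1 : Tendsto (fun n => ∫⁻ τ, ‖upperDefect t (f τ) (b n τ)‖ₑ ^ u.toReal ∂μ) atTop
        (𝓝 (∫⁻ _, 0 ∂μ)) := by
      refine tendsto_lintegral_of_dominated_convergence'
        (fun τ => ENNReal.ofReal (2 ^ s.toReal * ‖f τ‖ ^ s.toReal)) (fun n => ?_) (fun n => ?_) ?_ ?_
      · exact ((AEStronglyMeasurable.upperDefect ht (Lp.aestronglyMeasurable f)
          (Lp.aestronglyMeasurable (b n))).enorm).pow_const _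
      · filter_upwards with τ
        rw [Real.enorm_of_nonneg (upperDefect_nonneg _ _),
          ENNReal.ofReal_rpow_of_nonneg (upperDefect_nonneg _ _) hu'.le]
        refine ENNReal.ofReal_le_ofReal ?_
        refine (Real.rpow_le_rpow (upperDefect_nonneg _ _) (upperDefect_le ht _ _) hu'.le).trans_eq ?_
        rw [← Real.rpow_mul (by positivity), htu, Real.mul_rpow zero_le_two (norm_nonneg _)]
      · have := (((Lp.memLp f).integrable_norm_rpow hs0 hs).const_mul (2 ^ s.toReal)).lintegral_lt_top
        exact this.ne
      · filter_upwards [hφ] with τ hτ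
        have h2 := h (f τ) (fun n => b n τ) hτ
        have h3 := (((ENNReal.continuous_rpow_const (y := u.toReal)).comp
          (continuous_enorm (E := ℝ))).tendsto 0).comp h2
        simpa [Function.comp_def, hu'] using h3
    have h2 := ((ENNReal.continuous_rpow_const (y := 1 / u.toReal)).tendsto _).comp h1
    simpa [Function.comp_def, hu'] using h2
  have hD' := (ENNReal.tendsto_toReal ENNReal.zero_ne_top).comp hD
  refine squeeze_zero (fun n => upperDefect_nonneg _ _) (fun n => ?_) hD'
  refine max_le ENNReal.toReal_nonneg ?_
  have := Lp.norm_add_rpow_le ht hts f (b n)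
  simp only [Function.comp_apply]
  linarith

/-- Here the exponent must be `s` itself: the `s`-th power of the norm is an integral, so the
pointwise lower estimates add up without Minkowski. -/
theorem HasLowerEstimate.lpMean {w : E → ℝ} (hw : IsWeakNorm w)
    [IsProbabilityMeasure μ] [Fact (1 ≤ s)] (hs : s ≠ ∞) (h : HasLowerEstimate w s.toReal) :
    HasLowerEstimate (lpMean w : Lp E s μ → ℝ) s.toReal := by
  intro f g hg
  refine tendsto_of_subseq_tendsto fun ns hns => ?_
  obtain ⟨φ, -, hφ⟩ := hw.exists_subseq_ae_tendsto Fact.out (hg.comp hns)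
  refine ⟨φ, ?_⟩
  set b : ℕ → Lp E s μ := fun n => g (ns (φ n)) with hb
  have hs0 : s ≠ 0 := (zero_lt_one.trans_le (Fact.out : 1 ≤ s)).ne'
  have ht : 0 < s.toReal := ENNReal.toReal_pos hs0 hs
  have hint : ∀ f : Lp E s μ, Integrable (fun τ => ‖f τ‖ ^ s.toReal) μ := fun f =>
    (Lp.memLp f).integrable_norm_rpow hs0 hs
  have hmeas : ∀ n, AEStronglyMeasurable (fun τ => lowerDefect s.toReal (f τ) (b n τ)) μ := fun n =>
    AEStronglyMeasurable.lowerDefect ht (Lp.aestronglyMeasurable f) (Lp.aestronglyMeasurable (b n))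
  have hbound : ∀ n τ, ‖lowerDefect s.toReal (f τ) (b n τ)‖ ≤ 2 * ‖f τ‖ ^ s.toReal := fun n τ => by
    rw [Real.norm_of_nonneg (lowerDefect_nonneg _ _)]
    exact lowerDefect_le ht _ _
  have hD : Tendsto (fun n => ∫ τ, lowerDefect s.toReal (f τ) (b n τ) ∂μ) atTop
      (𝓝 (∫ _, 0 ∂μ)) := by
    refine tendsto_integral_of_dominated_convergence (fun τ => 2 * ‖f τ‖ ^ s.toReal) hmeas
      ((hint f).const_mul 2) (fun n => Eventually.of_forall (hbound n)) ?_
    filter_upwards [hφ] with τ hτ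
    exact h (f τ) (fun n => b n τ) hτ
  rw [integral_zero] at hD
  refine squeeze_zero (fun n => lowerDefect_nonneg _ _) (fun n => ?_) hD
  refine max_le (integral_nonneg fun τ => lowerDefect_nonneg _ _) ?_
  change ‖f‖ ^ s.toReal + (‖b n‖ / 2) ^ s.toReal - ‖f + b n‖ ^ s.toReal ≤ _
  rw [Real.div_rpow (norm_nonneg _) zero_le_two, Lp.norm_rpow_eq_integral hs0 hs,
    Lp.norm_rpow_eq_integral hs0 hs, Lp.norm_rpow_eq_integral hs0 hs, ← integral_div,
    ← integral_add (hint f) ((hint (b n)).div_const _),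
    ← integral_sub (by exact (hint f).add ((hint (b n)).div_const _)) (hint _)]
  refine integral_mono_ae (((hint f).add ((hint (b n)).div_const _)).sub (hint _))
    (((hint f).const_mul 2).mono' (hmeas n) (Eventually.of_forall (hbound n))) ?_
  filter_upwards [Lp.coeFn_add f (b n)] with τ hτ
  rw [hτ, ← Real.div_rpow (norm_nonneg _) zero_le_two]
  exact le_max_right _ _

end AsymptoticEstimates

/-! ### Choosing almost disjoint vectors one at a time -/

section Selection

variable {E : Type*} [NormedAddCommGroup E] {w : E → ℝ} {t : ℝ} {κ : Type*}

theorem HasUpperEstimate.exists_norm_sum_rpow_le (h : HasUpperEstimate w t) (ht : 1 ≤ t)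
    (g : κ → ℕ → E) (β : κ → ℝ) (hβ : ∀ k n, ‖g k n‖ ≤ β k)
    (hg : ∀ k, Tendsto (fun n => w (g k n)) atTop (𝓝 0)) (F : Finset κ) :
    ∃ n : κ → ℕ, ‖∑ k ∈ F, g k (n k)‖ ^ t ≤ ∑ k ∈ F, (3 * β k) ^ t := by
  classical
  have ht0 : 0 < t := by linarith
  induction F using Finset.induction_on with
  | empty => exact ⟨fun _ => 0, by simp [ht0.ne']⟩
  | insert a F ha ih =>
    obtain ⟨n, hn⟩ := ih
    have hβ0 : 0 ≤ β a := (norm_nonneg _).trans (hβ a 0)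
    obtain ⟨m, hm⟩ : ∃ m, ‖(∑ k ∈ F, g k (n k)) + g a m‖ ^ t ≤
        ‖∑ k ∈ F, g k (n k)‖ ^ t + (3 * β a) ^ t := by
      rcases hβ0.eq_or_lt with h0 | h0
      · have : g a 0 = 0 := norm_le_zero_iff.1 (by rw [h0]; exact hβ a 0)
        exact ⟨0, by rw [this, add_zero]; have : 0 ≤ (3 * β a) ^ t := by positivity
                     linarith⟩
      · have hη : 0 < β a ^ t := by positivity
        obtain ⟨m, hm⟩ := ((h (∑ k ∈ F, g k (n k)) (g a) (hg a)).eventually_lt_const hη).exists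
        refine ⟨m, ?_⟩
        have h1 := (le_max_right _ _).trans_lt hm
        have h2 : (2 * ‖g a m‖) ^ t ≤ (2 * β a) ^ t :=
          Real.rpow_le_rpow (by positivity) (by linarith [hβ a m]) ht0.le
        -- The error allowed at this step is `β a ^ t`; superadditivity of the power absorbs it by
        -- raising the constant from 2 to 3.
        have h3 := Real.add_rpow_le_rpow_add (by positivity : 0 ≤ 2 * β a) hβ0 ht
        have h4 : 2 * β a + β a = 3 * β a := by ring
        rw [h4] at h3
        linarith
    refine ⟨Function.update n a m, ?_⟩
    have hsum : ∑ k ∈ F, g k (Function.update n a m k) = ∑ k ∈ F, g k (n k) :=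
      Finset.sum_congr rfl fun k hk => by
        rw [Function.update_of_ne (ne_of_mem_of_not_mem hk ha)]
    rw [Finset.sum_insert ha, Finset.sum_insert ha, hsum, Function.update_self, add_comm]
    linarith

theorem HasLowerEstimate.exists_le_norm_sum_rpow (h : HasLowerEstimate w t) (ht : 1 ≤ t)
    (g : κ → ℕ → E) (γ : κ → ℝ) (hγ0 : ∀ k, 0 ≤ γ k) (hγ : ∀ k n, γ k ≤ ‖g k n‖)
    (hz : ∀ k, γ k = 0 → ∀ n, g k n = 0)
    (hg : ∀ k, Tendsto (fun n => w (g k n)) atTop (𝓝 0)) (F : Finset κ) :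
    ∃ n : κ → ℕ, ∑ k ∈ F, (γ k / 4) ^ t ≤ ‖∑ k ∈ F, g k (n k)‖ ^ t := by
  classical
  have ht0 : 0 < t := by linarith
  induction F using Finset.induction_on with
  | empty => exact ⟨fun _ => 0, by simp [ht0.ne']⟩
  | insert a F ha ih =>
    obtain ⟨n, hn⟩ := ih
    obtain ⟨m, hm⟩ : ∃ m, ‖∑ k ∈ F, g k (n k)‖ ^ t + (γ a / 4) ^ t ≤
        ‖(∑ k ∈ F, g k (n k)) + g a m‖ ^ t := by
      rcases (hγ0 a).eq_or_lt with h0 | h0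
      -- A zero lower bound leaves no room for an error, so the vector itself has to vanish.
      · exact ⟨0, by rw [hz a h0.symm 0, ← h0]; simp [ht0.ne']⟩
      · have hη : 0 < (γ a / 4) ^ t := by positivity
        obtain ⟨m, hm⟩ := ((h (∑ k ∈ F, g k (n k)) (g a) (hg a)).eventually_lt_const hη).exists
        refine ⟨m, ?_⟩
        have h1 := (le_max_right _ _).trans_lt hm
        have h2 : (γ a / 2) ^ t ≤ (‖g a m‖ / 2) ^ t :=
          Real.rpow_le_rpow (by positivity) (by linarith [hγ a m]) ht0.le
        have h3 := Real.add_rpow_le_rpow_add (by positivity : 0 ≤ γ a / 4)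
          (by positivity : 0 ≤ γ a / 4) ht
        have h4 : γ a / 4 + γ a / 4 = γ a / 2 := by ring
        rw [h4] at h3
        linarith
    refine ⟨Function.update n a m, ?_⟩
    have hsum : ∑ k ∈ F, g k (Function.update n a m k) = ∑ k ∈ F, g k (n k) :=
      Finset.sum_congr rfl fun k hk => by
        rw [Function.update_of_ne (ne_of_mem_of_not_mem hk ha)]
    rw [Finset.sum_insert ha, Finset.sum_insert ha, hsum, Function.update_self,
      add_comm (g a m)]
    linarith

end Selection

theorem exponent_le_of_forall_nat {a b x y : ℝ} (ha : 0 < a)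
    (h : ∀ m : ℕ, 0 < m → a * (m : ℝ) ^ x ≤ b * (m : ℝ) ^ y) : x ≤ y := by
  by_contra! hxy
  have h1 : Tendsto (fun m : ℕ => (m : ℝ) ^ (x - y)) atTop atTop :=
    (tendsto_rpow_atTop (by linarith : 0 < x - y)).comp tendsto_natCast_atTop_atTop
  obtain ⟨m, hm, hm0⟩ := ((h1.eventually_gt_atTop (b / a)).and (eventually_gt_atTop 0)).exists
  have hm' : (0 : ℝ) < m := by exact_mod_cast hm0
  have h2 := h m hm0
  rw [Real.rpow_sub hm', div_lt_div_iff₀ ha (by positivity)] at hm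
  linarith

/-! ### Images of the unit vectors of `ℓ_p` are weakly negligible -/

section UnitVectors

variable {𝕜 : Type*} [RCLike 𝕜] {p : ℝ≥0∞}

theorem lp.norm_sum_single_of_norm_eq_one [Fact (1 ≤ p)] (hp : 0 < p.toReal) (A : Finset ℕ) (ε : ℕ → 𝕜)
    (hε : ∀ i ∈ A, ‖ε i‖ = 1) :
    ‖∑ i ∈ A, (lp.single p i (ε i) : lp (fun _ : ℕ => 𝕜) p)‖ = (A.card : ℝ) ^ (1 / p.toReal) := by
  have h := lp.norm_sum_single (E := fun _ : ℕ => 𝕜) hp ε A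
  rw [Finset.sum_congr rfl fun i hi => congrArg (· ^ p.toReal) (hε i hi)] at h
  simp only [Real.one_rpow, Finset.sum_const, nsmul_eq_mul, mul_one] at h
  rw [one_div, Real.eq_rpow_inv (norm_nonneg _) (Nat.cast_nonneg _) hp.ne']
  exact h

theorem HasSignBound.tendsto_map_single [Fact (1 ≤ p)] {Y : Type*} [NormedAddCommGroup Y]
    [NormedSpace 𝕜 Y] {w : Y → ℝ} {q : ℝ} (h : HasSignBound w q) (hw : IsWeakNorm w) (hq : 0 < q)
    (hqp : q < p.toReal) (T : lp (fun _ : ℕ => 𝕜) p →L[𝕜] Y) :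
    Tendsto (fun n => w (T (lp.single p n 1))) atTop (𝓝 0) := by
  obtain ⟨c, hc, h⟩ := h
  have hp : 0 < p.toReal := hq.trans hqp
  have hfin : ∀ δ > 0, {n | δ ≤ w (T (lp.single p n 1))}.Finite := by
    intro δ hδ
    by_contra hinf
    have hle : 1 / q ≤ 1 / p.toReal := by
      refine exponent_le_of_forall_nat (a := c * δ) (b := ‖T‖) (by positivity) fun m hm => ?_
      obtain ⟨A, hA, hAm⟩ := Set.Infinite.exists_subset_card_eq hinf m
      have hm' : (0 : ℝ) < m := by exact_mod_cast hm
      have h1 := h A fun n => T (lp.single p n 1)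
      have h2 : ∀ B ∈ A.powerset, w (signSum A B fun n => T (lp.single p n 1)) ≤
          ‖T‖ * (m : ℝ) ^ (1 / p.toReal) := by
        intro B _
        refine (hw.le_norm _).trans ?_
        have h5 := map_signSum (T : lp (fun _ : ℕ => 𝕜) p →+ Y) A B (fun n => lp.single p n 1)
        have h3 : signSum A B (fun n => (lp.single p n 1 : lp (fun _ : ℕ => 𝕜) p)) =
            ∑ n ∈ A, lp.single p n (if n ∈ B then 1 else -1) := by
          refine Finset.sum_congr rfl fun n _ => ?_
          split_ifs <;> simp
        have h4 := lp.norm_sum_single_of_norm_eq_one hp A (fun n => if n ∈ B then (1 : 𝕜) else -1)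
          (fun n _ => by split_ifs <;> simp)
        rw [← h3, hAm] at h4
        rw [← h4]
        exact (congrArg norm h5.symm).trans_le (T.le_opNorm _)
      have h3 := Finset.sum_le_sum h2
      rw [Finset.sum_const, Finset.card_powerset, nsmul_eq_mul, hAm] at h3
      have h4 : (m : ℝ) * δ ≤ ∑ n ∈ A, w (T (lp.single p n 1)) := by
        rw [← hAm, ← nsmul_eq_mul, ← Finset.sum_const]
        exact Finset.sum_le_sum fun n hn => hA hn
      rw [hAm] at h1
      have h5 : c * 2 ^ m * (m : ℝ) ^ (1 / q - 1) * (m * δ) ≤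
          2 ^ m * (‖T‖ * (m : ℝ) ^ (1 / p.toReal)) := by
        refine le_trans (by gcongr) (h1.trans (h3.trans_eq ?_))
        push_cast
        rfl
      rw [Real.rpow_sub hm', Real.rpow_one] at h5
      have h6 : (2 : ℝ) ^ m * (c * δ * (m : ℝ) ^ (1 / q)) ≤
          2 ^ m * (‖T‖ * (m : ℝ) ^ (1 / p.toReal)) := by
        refine le_trans (le_of_eq ?_) h5
        field_simp
      exact le_of_mul_le_mul_left h6 (by positivity)
    exact absurd hle (not_le.2 (one_div_lt_one_div_of_lt hq hqp))
  rw [← Nat.cofinite_eq_atTop]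
  refine Metric.tendsto_nhds.2 fun δ hδ => ?_
  refine (hfin δ hδ).subset fun n hn => ?_
  simpa [Real.dist_eq, abs_of_nonneg (hw.nonneg _)] using hn

end UnitVectors

/-! ### Coordinate embeddings into `U(X)` and consequences of an embedding -/

namespace FunctionNorm

variable {ι : Type*} {ρ : FunctionNorm ι}

theorem IsNormalized.toFun_smul_indicator (hρ : ρ.IsNormalized) (i : ι) (a : ℝ≥0) :
    ρ.toFun (a • Set.indicator {i} 1) = a := by
  rw [ρ.smul', hρ i, mul_one]

section Coordinates

variable (𝕜 : Type*) [RCLike 𝕜] (X : Type*) [NormedAddCommGroup X] [NormedSpace 𝕜 X]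

open Classical in
theorem nnnorm_single (i : ι) (x : X) :
    (fun j => ‖(Pi.single i x : ι → X) j‖₊) = ‖x‖₊ • Set.indicator {i} 1 := by
  ext j
  by_cases h : j = i
  · subst h; simp
  · simp [h]

open Classical in
theorem single_mem_submodule (hρ : ρ.IsNormalized) (i : ι) (x : X) :
    (Pi.single i x : ι → X) ∈ ρ.submodule 𝕜 X := by
  change ρ.toFun _ < ∞
  rw [nnnorm_single, hρ.toFun_smul_indicator]
  exact ENNReal.coe_lt_top

open Classical in
/-- The function with value `x` at `i` that vanishes elsewhere. -/
noncomputable def singleFun (hρ : ρ.IsNormalized) (i : ι) (x : X) : ρ.Space 𝕜 X :=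
  ⟨Pi.single i x, single_mem_submodule 𝕜 X hρ i x⟩

open Classical in
theorem norm_singleFun (hρ : ρ.IsNormalized) (i : ι) (x : X) :
    ‖singleFun 𝕜 X hρ i x‖ = ‖x‖ := by
  rw [Space.norm_def]
  change (ρ.toFun fun j => ‖(Pi.single i x : ι → X) j‖₊).toReal = _
  rw [nnnorm_single, hρ.toFun_smul_indicator]
  rfl

open Classical in
/-- The embedding of `X` into the `i`-th coordinate of `L_ρ(X)`. -/
noncomputable def single (hρ : ρ.IsNormalized) (i : ι) : X →L[𝕜] ρ.Space 𝕜 X :=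
  LinearMap.mkContinuous
    { toFun := singleFun 𝕜 X hρ i
      map_add' := fun x y => Subtype.ext (Pi.single_add (f := fun _ : ι => X) i x y)
      map_smul' := fun a x => Subtype.ext (Pi.single_smul (f := fun _ : ι => X) i a x) } 1
    fun x => by
      rw [one_mul]
      exact (norm_singleFun 𝕜 X hρ i x).le

open Classical in
theorem coe_single (hρ : ρ.IsNormalized) (i : ι) (x : X) :
    (single 𝕜 X hρ i x : ι → X) = Pi.single i x := rfl

theorem norm_single (hρ : ρ.IsNormalized) (i : ι) (x : X) : ‖single 𝕜 X hρ i x‖ = ‖x‖ :=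
  norm_singleFun 𝕜 X hρ i x

theorem Space.coe_sum {κ : Type*} (F : Finset κ) (f : κ → ρ.Space 𝕜 X) (i : ι) :
    (∑ k ∈ F, f k : ρ.Space 𝕜 X) i = ∑ k ∈ F, f k i :=
  map_sum ({ toFun := fun g => g i, map_zero' := rfl, map_add' := fun _ _ => rfl } :
    ρ.Space 𝕜 X →+ X) f F

open Classical in
theorem sum_single_apply (hρ : ρ.IsNormalized) (F : Finset ι) (f : ι → X) (i : ι) :
    (∑ k ∈ F, single 𝕜 X hρ k (f k) : ρ.Space 𝕜 X) i = if i ∈ F then f i else 0 := by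
  rw [Space.coe_sum]
  simp only [coe_single]
  exact Finset.sum_pi_single i f F

open Classical in
theorem toFun_sum_single (hρ : ρ.IsNormalized) (F : Finset ι) (f : ι → X) :
    (fun i => ‖(∑ k ∈ F, single 𝕜 X hρ k (f k) : ρ.Space 𝕜 X) i‖₊) =
      fun i => if i ∈ F then ‖f i‖₊ else 0 := by
  ext i
  rw [sum_single_apply]
  split_ifs <;> simp

open Classical in
theorem norm_sum_single (hρ : ρ.IsNormalized) (F : Finset ι) (f : ι → X) :
    ‖∑ k ∈ F, single 𝕜 X hρ k (f k)‖ =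
      (ρ.toFun fun i => if i ∈ F then ‖f i‖₊ else 0).toReal := by
  rw [Space.norm_def, toFun_sum_single]

end Coordinates

section Embedding

variable {𝕜 : Type*} [RCLike 𝕜] {p : ℝ≥0∞} [Fact (1 ≤ p)] {Y : Type*} [NormedAddCommGroup Y]
  [NormedSpace 𝕜 Y] {w : Y → ℝ} {q t : ℝ}
  {J : ρ.Space 𝕜 (lp (fun _ : ℕ => 𝕜) p) →L[𝕜] Y} {c : ℝ}

theorem tendsto_map_single (hρ : ρ.IsNormalized) (hsign : HasSignBound w q) (hw : IsWeakNorm w)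
    (hq : 0 < q) (hqp : q < p.toReal) (J : ρ.Space 𝕜 (lp (fun _ : ℕ => 𝕜) p) →L[𝕜] Y)
    (i : ι) (a : 𝕜) :
    Tendsto (fun n => w (J (single 𝕜 _ hρ i (a • lp.single p n 1)))) atTop (𝓝 0) := by
  simpa using hsign.tendsto_map_single hw hq hqp (a • (J ∘L single 𝕜 _ hρ i))

/-- Pairing with `k` reserves disjoint sets of positions for different `k`, so any choice of `n`
yields distinct unit vectors. -/
theorem norm_sum_single_pair (hρ : ρ.IsNormalized) (hp : 0 < p.toReal) (i : ι) (m : ℕ)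
    (n : ℕ → ℕ) :
    ‖∑ k ∈ Finset.range m, single 𝕜 (lp (fun _ : ℕ => 𝕜) p) hρ i
      ((1 : 𝕜) • lp.single p (Nat.pair k (n k)) 1)‖ = (m : ℝ) ^ (1 / p.toReal) := by
  have hinj : Set.InjOn (fun k => Nat.pair k (n k)) (Finset.range m) := fun k _ l _ h =>
    (Nat.pair_eq_pair.1 h).1
  rw [← map_sum, norm_single]
  simp only [one_smul]
  rw [← Finset.sum_image (g := fun k => Nat.pair k (n k))
    (f := fun j => (lp.single p j 1 : lp (fun _ : ℕ => 𝕜) p)) hinj,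
    lp.norm_sum_single_of_norm_eq_one hp _ (fun _ => 1) (fun _ _ => norm_one),
    Finset.card_image_of_injOn hinj, Finset.card_range]

theorem norm_single_smul (hρ : ρ.IsNormalized) (i : ι) (a : 𝕜) (n : ℕ) (hp : 0 < p) :
    ‖single 𝕜 (lp (fun _ : ℕ => 𝕜) p) hρ i (a • lp.single p n 1)‖ = ‖a‖ := by
  rw [norm_single, norm_smul, lp.norm_single hp, norm_one, mul_one]

theorem norm_map_single_le (hρ : ρ.IsNormalized) (hp : 0 < p)
    (J : ρ.Space 𝕜 (lp (fun _ : ℕ => 𝕜) p) →L[𝕜] Y) (i : ι) (a : 𝕜) (n : ℕ) :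
    ‖J (single 𝕜 _ hρ i (a • lp.single p n 1))‖ ≤ ‖J‖ * ‖a‖ := by
  rw [← norm_single_smul hρ i a n hp]
  exact J.le_opNorm _

theorem le_norm_map_single (hρ : ρ.IsNormalized) (hp : 0 < p) (hJ : ∀ x, c * ‖x‖ ≤ ‖J x‖)
    (i : ι) (a : 𝕜) (n : ℕ) : c * ‖a‖ ≤ ‖J (single 𝕜 _ hρ i (a • lp.single p n 1))‖ := by
  rw [← norm_single_smul hρ i a n hp]
  exact hJ _

theorem tendsto_pair_atTop (k : ℕ) : Tendsto (fun n => Nat.pair k n) atTop atTop :=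
  tendsto_atTop_mono (fun n => Nat.right_le_pair k n) tendsto_id

theorem upperEstimate_exponent_le [Nonempty ι] (hρ : ρ.IsNormalized) (hsign : HasSignBound w q)
    (hw : IsWeakNorm w) (hq : 0 < q) (hqp : q < p.toReal) (ht : 1 ≤ t)
    (hup : HasUpperEstimate w t) (hc : 0 < c) (hJ : ∀ x, c * ‖x‖ ≤ ‖J x‖) : t ≤ p.toReal := by
  obtain ⟨i⟩ := ‹Nonempty ι›
  have hp : 0 < p.toReal := hq.trans hqp
  have hp' : 0 < p := (ENNReal.toReal_pos_iff.1 hp).1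
  have key : t / p.toReal ≤ 1 := by
    refine exponent_le_of_forall_nat (a := c ^ t) (b := (3 * ‖J‖) ^ t) (by positivity)
      fun m hm => ?_
    obtain ⟨n, hn⟩ := hup.exists_norm_sum_rpow_le ht
      (fun k n => J (single 𝕜 _ hρ i ((1 : 𝕜) • lp.single p (Nat.pair k n) 1))) (fun _ => ‖J‖)
      (fun k n => by simpa only [norm_one, mul_one] using
        norm_map_single_le hρ hp' J i (1 : 𝕜) (Nat.pair k n))
      (fun k => (tendsto_map_single hρ hsign hw hq hqp J i 1).comp (tendsto_pair_atTop k))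
      (Finset.range m)
    rw [← map_sum, Finset.sum_const, Finset.card_range, nsmul_eq_mul] at hn
    have h1 := hJ (∑ k ∈ Finset.range m, single 𝕜 (lp (fun _ : ℕ => 𝕜) p) hρ i
      ((1 : 𝕜) • lp.single p (Nat.pair k (n k)) 1))
    rw [norm_sum_single_pair hρ hp] at h1
    have h2 := (Real.rpow_le_rpow (by positivity) h1 (by linarith)).trans hn
    rw [Real.mul_rpow hc.le (by positivity), ← Real.rpow_mul (by positivity)] at h2
    rw [Real.rpow_one, mul_comm _ (m : ℝ)]
    refine le_trans (le_of_eq ?_) h2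
    congr 2
    ring
  rwa [div_le_one hp] at key

theorem le_lowerEstimate_exponent [Nonempty ι] (hρ : ρ.IsNormalized) (hsign : HasSignBound w q)
    (hw : IsWeakNorm w) (hq : 0 < q) (hqp : q < p.toReal) (ht : 1 ≤ t)
    (hlow : HasLowerEstimate w t) (hc : 0 < c) (hJ : ∀ x, c * ‖x‖ ≤ ‖J x‖) : p.toReal ≤ t := by
  obtain ⟨i⟩ := ‹Nonempty ι›
  have hp : 0 < p.toReal := hq.trans hqp
  have hp' : 0 < p := (ENNReal.toReal_pos_iff.1 hp).1
  have key : 1 ≤ t / p.toReal := by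
    refine exponent_le_of_forall_nat (a := (c / 4) ^ t) (b := ‖J‖ ^ t) (by positivity)
      fun m hm => ?_
    obtain ⟨n, hn⟩ := hlow.exists_le_norm_sum_rpow ht
      (fun k n => J (single 𝕜 _ hρ i ((1 : 𝕜) • lp.single p (Nat.pair k n) 1))) (fun _ => c)
      (fun _ => hc.le)
      (fun k n => by simpa only [norm_one, mul_one] using
        le_norm_map_single hρ hp' hJ i (1 : 𝕜) (Nat.pair k n))
      (fun _ h => absurd h hc.ne')
      (fun k => (tendsto_map_single hρ hsign hw hq hqp J i 1).comp (tendsto_pair_atTop k))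
      (Finset.range m)
    rw [← map_sum, Finset.sum_const, Finset.card_range, nsmul_eq_mul] at hn
    have h1 := J.le_opNorm (∑ k ∈ Finset.range m, single 𝕜 (lp (fun _ : ℕ => 𝕜) p) hρ i
      ((1 : 𝕜) • lp.single p (Nat.pair k (n k)) 1))
    rw [norm_sum_single_pair hρ hp] at h1
    have h2 := hn.trans (Real.rpow_le_rpow (by positivity) h1 (by linarith))
    rw [Real.mul_rpow (by positivity) (by positivity), ← Real.rpow_mul (by positivity)] at h2
    rw [Real.rpow_one, mul_comm _ (m : ℝ)]
    refine h2.trans (le_of_eq ?_)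
    congr 2
    ring
  rwa [le_div_iff₀ hp, one_mul] at key

/-- The norm does not see which unit vector is used in each coordinate, so the positions `n k` are
free for the selection argument. -/
theorem norm_sum_single_smul (hρ : ρ.IsNormalized) (hp : 0 < p) (F : Finset ι) (f : ι → 𝕜)
    (n : ι → ℕ) :
    ‖∑ k ∈ F, single 𝕜 (lp (fun _ : ℕ => 𝕜) p) hρ k (f k • lp.single p (n k) 1)‖ =
      ‖∑ k ∈ F, single 𝕜 𝕜 hρ k (f k)‖ := by
  rw [norm_sum_single 𝕜 _ hρ F (fun k => f k • lp.single p (n k) 1), norm_sum_single 𝕜 𝕜 hρ F f]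
  have : ∀ k, ‖f k • (lp.single p (n k) 1 : lp (fun _ : ℕ => 𝕜) p)‖₊ = ‖f k‖₊ := fun k => by
    ext
    rw [coe_nnnorm, norm_smul, lp.norm_single hp, norm_one, mul_one, coe_nnnorm]
  simp only [this]

theorem exists_norm_sum_single_rpow_le (hρ : ρ.IsNormalized) (hsign : HasSignBound w q)
    (hw : IsWeakNorm w) (hq : 0 < q) (hqp : q < p.toReal) (ht : 1 ≤ t)
    (hup : HasUpperEstimate w t) (hc : 0 < c) (hJ : ∀ x, c * ‖x‖ ≤ ‖J x‖) :
    ∃ C : ℝ, 0 ≤ C ∧ ∀ (F : Finset ι) (f : ι → 𝕜),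
      ‖∑ k ∈ F, single 𝕜 𝕜 hρ k (f k)‖ ^ t ≤ C ^ t * ∑ k ∈ F, ‖f k‖ ^ t := by
  have hp : 0 < p.toReal := hq.trans hqp
  have hp' : 0 < p := (ENNReal.toReal_pos_iff.1 hp).1
  refine ⟨3 * ‖J‖ / c, by positivity, fun F f => ?_⟩
  obtain ⟨n, hn⟩ := hup.exists_norm_sum_rpow_le ht
    (fun k n => J (single 𝕜 _ hρ k (f k • lp.single p n 1))) (fun k => ‖J‖ * ‖f k‖)
    (fun k n => norm_map_single_le hρ hp' J k (f k) n)
    (fun k => tendsto_map_single hρ hsign hw hq hqp J k (f k)) F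
  rw [← map_sum] at hn
  have h1 := hJ (∑ k ∈ F, single 𝕜 (lp (fun _ : ℕ => 𝕜) p) hρ k (f k • lp.single p (n k) 1))
  rw [norm_sum_single_smul hρ hp'] at h1
  have h2 := (Real.rpow_le_rpow (by positivity) h1 (by linarith)).trans hn
  simp only [← mul_assoc] at h2
  rw [Finset.sum_congr rfl fun k _ => Real.mul_rpow (by positivity) (norm_nonneg (f k)),
    ← Finset.mul_sum, Real.mul_rpow hc.le (norm_nonneg _)] at h2
  rw [Real.div_rpow (by positivity) hc.le, div_mul_eq_mul_div, le_div_iff₀ (by positivity)]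
  linarith

theorem exists_sum_norm_rpow_le (hρ : ρ.IsNormalized) (hsign : HasSignBound w q)
    (hw : IsWeakNorm w) (hq : 0 < q) (hqp : q < p.toReal) (ht : 1 ≤ t)
    (hlow : HasLowerEstimate w t) (hc : 0 < c) (hJ : ∀ x, c * ‖x‖ ≤ ‖J x‖) :
    ∃ C : ℝ, 0 ≤ C ∧ ∀ (F : Finset ι) (f : ι → 𝕜),
      ∑ k ∈ F, ‖f k‖ ^ t ≤ C ^ t * ‖∑ k ∈ F, single 𝕜 𝕜 hρ k (f k)‖ ^ t := by
  have hp : 0 < p.toReal := hq.trans hqp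
  have hp' : 0 < p := (ENNReal.toReal_pos_iff.1 hp).1
  refine ⟨‖J‖ / (c / 4), by positivity, fun F f => ?_⟩
  obtain ⟨n, hn⟩ := hlow.exists_le_norm_sum_rpow ht
    (fun k n => J (single 𝕜 _ hρ k (f k • lp.single p n 1))) (fun k => c * ‖f k‖)
    (fun k => by positivity) (fun k n => le_norm_map_single hρ hp' hJ k (f k) n)
    (fun k hk n => by
      have : f k = 0 := by simpa [hc.ne'] using hk
      simp [this])
    (fun k => tendsto_map_single hρ hsign hw hq hqp J k (f k)) F
  rw [← map_sum] at hn
  have h1 := J.le_opNorm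
    (∑ k ∈ F, single 𝕜 (lp (fun _ : ℕ => 𝕜) p) hρ k (f k • lp.single p (n k) 1))
  rw [norm_sum_single_smul hρ hp'] at h1
  have h2 := hn.trans (Real.rpow_le_rpow (by positivity) h1 (by linarith))
  have h3 : ∀ k, c * ‖f k‖ / 4 = c / 4 * ‖f k‖ := fun k => by ring
  simp only [h3] at h2
  rw [Finset.sum_congr rfl fun k _ => Real.mul_rpow (by positivity) (norm_nonneg (f k)),
    ← Finset.mul_sum, Real.mul_rpow (norm_nonneg _) (norm_nonneg _)] at h2
  rw [Real.div_rpow (by positivity) (by positivity), div_mul_eq_mul_div,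
    le_div_iff₀ (by positivity)]
  linarith

end Embedding

/-! ### From estimates on finite sets to a lattice isomorphism -/

section LatticeIso

variable {𝕜 : Type*} [RCLike 𝕜] {p : ℝ≥0∞} [Fact (1 ≤ p)]

theorem norm_sum_single_le_norm (hρ : ρ.IsNormalized) (F : Finset ι) (f : ρ.Space 𝕜 𝕜) :
    ‖∑ k ∈ F, single 𝕜 𝕜 hρ k (f k)‖ ≤ ‖f‖ := by
  classical
  rw [norm_sum_single 𝕜 𝕜 hρ F f, Space.norm_def]
  refine ENNReal.toReal_mono f.2.ne (ρ.mono' _ _ fun i => ?_)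
  split_ifs <;> simp

theorem toFun_le_of_forall_finset [Countable ι] [Nonempty ι] (g : ι → ℝ≥0) (C : ℝ≥0∞)
    (h : ∀ F : Finset ι, ρ.toFun (Set.indicator F g) ≤ C) : ρ.toFun g ≤ C := by
  classical
  obtain ⟨e, he⟩ := exists_surjective_nat ι
  have hmono : Monotone fun n => (Finset.range n).image e := fun m n hmn =>
    Finset.image_subset_image (Finset.range_mono hmn)
  refine le_of_tendsto' (ρ.fatou' (fun n => Set.indicator ((Finset.range n).image e) g) g
    (fun m n hmn i => ?_) fun i => ?_) fun n => h _
  · exact Set.indicator_le_indicator_of_subset (Finset.coe_subset.2 (hmono hmn))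
      (fun _ => zero_le) i
  · obtain ⟨k, rfl⟩ := he i
    refine tendsto_const_nhds.congr' ?_
    filter_upwards [eventually_gt_atTop k] with n hn
    rw [Set.indicator_of_mem]
    exact Finset.mem_coe.2 (Finset.mem_image_of_mem e (Finset.mem_range.2 hn))

/-- The isomorphism is the identity on functions, hence preserves moduli. Membership in `ℓ_p`
follows from bounded finite sums, membership in `U` from the Fatou property. -/
theorem latticeIsoLp_of_equivalent [Countable ι] [Nonempty ι] (hρ : ρ.IsNormalized)
    (hp : 0 < p.toReal) {C₁ C₂ : ℝ} (hC₁ : 0 ≤ C₁) (hC₂ : 0 ≤ C₂)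
    (h₁ : ∀ (F : Finset ι) (f : ι → 𝕜), ‖∑ k ∈ F, single 𝕜 𝕜 hρ k (f k)‖ ^ p.toReal ≤
      C₁ ^ p.toReal * ∑ k ∈ F, ‖f k‖ ^ p.toReal)
    (h₂ : ∀ (F : Finset ι) (f : ι → 𝕜), ∑ k ∈ F, ‖f k‖ ^ p.toReal ≤
      C₂ ^ p.toReal * ‖∑ k ∈ F, single 𝕜 𝕜 hρ k (f k)‖ ^ p.toReal) :
    ρ.LatticeIsoLp 𝕜 p := by
  classical
  have hsum : ∀ (f : ρ.Space 𝕜 𝕜) (F : Finset ι),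
      ∑ k ∈ F, ‖f k‖ ^ p.toReal ≤ (C₂ * ‖f‖) ^ p.toReal := fun f F => by
    refine (h₂ F f).trans ?_
    rw [Real.mul_rpow hC₂ (norm_nonneg _)]
    have := norm_sum_single_le_norm hρ F f
    gcongr
  have hfatou : ∀ f : lp (fun _ : ι => 𝕜) p,
      ρ.toFun (fun i => ‖f i‖₊) ≤ ENNReal.ofReal (C₁ * ‖f‖) := by
    intro f
    refine toFun_le_of_forall_finset _ _ fun F => ?_
    have h3 : Set.indicator (F : Set ι) (fun i => ‖f i‖₊) =
        fun i => ‖(∑ k ∈ F, single 𝕜 𝕜 hρ k (f k) : ρ.Space 𝕜 𝕜) i‖₊ := by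
      rw [toFun_sum_single]
      ext i
      simp [Set.indicator_apply]
    rw [h3, ← ENNReal.ofReal_toReal (∑ k ∈ F, single 𝕜 𝕜 hρ k (f k) : ρ.Space 𝕜 𝕜).2.ne]
    refine ENNReal.ofReal_le_ofReal ?_
    rw [← Space.norm_def]
    refine (Real.rpow_le_rpow_iff (norm_nonneg _) (by positivity) hp).1 ((h₁ F f).trans ?_)
    rw [Real.mul_rpow hC₁ (norm_nonneg _)]
    gcongr
    exact lp.sum_rpow_le_norm_rpow hp f F
  let e : ρ.Space 𝕜 𝕜 ≃ₗ[𝕜] lp (fun _ : ι => 𝕜) p :=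
    { toFun := fun f => ⟨fun i => f i, memℓp_gen' (hsum f)⟩
      invFun := fun f => ⟨fun i => f i, (hfatou f).trans_lt ENNReal.ofReal_lt_top⟩
      map_add' := fun _ _ => rfl
      map_smul' := fun _ _ => rfl
      left_inv := fun _ => rfl
      right_inv := fun _ => rfl }
  refine ⟨e.toContinuousLinearEquivOfBounds C₂ C₁ (fun f => ?_) (fun f => ?_), fun f i => rfl⟩
  · exact lp.norm_le_of_forall_sum_le hp (by positivity) (hsum f)
  · exact ENNReal.toReal_le_of_le_ofReal (by positivity) (hfatou f)

end LatticeIso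

end FunctionNorm

/-! ### The two choices of weak norm on `L_s(L_r)` -/

section MixedNorm

variable {𝕜 : Type*} [RCLike 𝕜] {ι : Type*} [Nonempty ι] {p r s : ℝ≥0∞} [Fact (1 ≤ p)]
  [Fact (1 ≤ r)] [Fact (1 ≤ s)] {ρ : FunctionNorm ι}

/-- Averaging the modulus over both variables keeps `q = 2`, so `r` need not be compared with `p`.
The price is that the upper estimate must pass through both `L_r` and `L_s`, which limits `t` to
`min r s`. -/
theorem min_le_of_embeds_mixedLp (hp : 2 < p.toReal) (hr : r ≠ ∞) (hs : s ≠ ∞)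
    (hρ : ρ.IsNormalized)
    (h : IsomorphicallyEmbeds 𝕜 (ρ.Space 𝕜 (lp (fun _ : ℕ => 𝕜) p)) (MixedLp 𝕜 s r)) :
    (min r s).toReal ≤ p.toReal := by
  obtain ⟨J, c, hc, hJ⟩ := h
  have hm1 : 1 ≤ min r s := le_min Fact.out Fact.out
  have hm : min r s ≠ ∞ := ne_top_of_le_ne_top hr (min_le_left _ _)
  have ht : 1 ≤ (min r s).toReal := by
    simpa using ENNReal.toReal_mono hm hm1
  have ht0 : 0 < (min r s).toReal := by linarith
  have hw := isWeakNorm_norm (E := 𝕜)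
  have hw₁ : IsWeakNorm (lpMean (fun x : 𝕜 => ‖x‖) : Lp 𝕜 r (volume : Measure unitInterval) → ℝ) :=
    hw.lpMean
  refine FunctionNorm.upperEstimate_exponent_le hρ
    (((hasSignBound_scalar 𝕜).lpMean hw).lpMean hw₁) hw₁.lpMean two_pos hp ht
    (((hasUpperEstimate_norm ht0).lpMean hw hr ht0 ?_).lpMean hw₁ hs ht0 ?_) hc hJ
  · rw [ENNReal.ofReal_toReal hm]
    exact min_le_left _ _
  · rw [ENNReal.ofReal_toReal hm]
    exact min_le_right _ _

/-- Averaging the `L_r`-norm over the outer variable only gives both estimates with the same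
exponent `s`. The price is `q = max(r, 2)`, hence the assumption that `r < p`. -/
theorem eq_and_latticeIsoLp_of_embeds_mixedLp [Countable ι] (hp : 2 < p.toReal)
    (hrp : r.toReal < p.toReal) (hr : r ≠ ∞) (hs : s ≠ ∞) (hρ : ρ.IsNormalized)
    (h : IsomorphicallyEmbeds 𝕜 (ρ.Space 𝕜 (lp (fun _ : ℕ => 𝕜) p)) (MixedLp 𝕜 s r)) :
    p.toReal = s.toReal ∧ ρ.LatticeIsoLp 𝕜 p := by
  obtain ⟨J, c, hc, hJ⟩ := h
  have ht : 1 ≤ s.toReal := by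
    simpa using ENNReal.toReal_mono hs (Fact.out : 1 ≤ s)
  have ht0 : 0 < s.toReal := by linarith
  have hq : 0 < max r.toReal 2 := lt_max_of_lt_right two_pos
  have hqp : max r.toReal 2 < p.toReal := max_lt hrp hp
  have hw := isWeakNorm_norm (E := Lp 𝕜 r (volume : Measure unitInterval))
  have hw' : IsWeakNorm (lpMean (fun x : Lp 𝕜 r (volume : Measure unitInterval) => ‖x‖) :
    MixedLp 𝕜 s r → ℝ) := hw.lpMean
  have hsign : HasSignBound (lpMean (fun x : Lp 𝕜 r (volume : Measure unitInterval) => ‖x‖) :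
    MixedLp 𝕜 s r → ℝ) (max r.toReal 2) := (Lp.hasSignBound_norm 𝕜 hr).lpMean hw
  have hup : HasUpperEstimate (lpMean (fun x : Lp 𝕜 r (volume : Measure unitInterval) => ‖x‖) :
    MixedLp 𝕜 s r → ℝ) s.toReal :=
    (hasUpperEstimate_norm ht0).lpMean hw hs ht0 (ENNReal.ofReal_toReal hs).le
  have hlow : HasLowerEstimate (lpMean (fun x : Lp 𝕜 r (volume : Measure unitInterval) => ‖x‖) :
    MixedLp 𝕜 s r → ℝ) s.toReal := (hasLowerEstimate_norm ht0).lpMean hw hs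
  have hps : p.toReal = s.toReal :=
    le_antisymm (FunctionNorm.le_lowerEstimate_exponent hρ hsign hw' hq hqp ht hlow hc hJ)
      (FunctionNorm.upperEstimate_exponent_le hρ hsign hw' hq hqp ht hup hc hJ)
  refine ⟨hps, ?_⟩
  obtain ⟨C₁, hC₁, h₁⟩ :=
    FunctionNorm.exists_norm_sum_single_rpow_le hρ hsign hw' hq hqp ht hup hc hJ
  obtain ⟨C₂, hC₂, h₂⟩ :=
    FunctionNorm.exists_sum_norm_rpow_le hρ hsign hw' hq hqp ht hlow hc hJ
  rw [← hps] at h₁ h₂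
  exact FunctionNorm.latticeIsoLp_of_equivalent hρ (by linarith) hC₁ hC₂ h₁ h₂

end MixedNorm

theorem proposition3p8 {𝕜 : Type*} [RCLike 𝕜] {ι : Type*} [Countable ι] [Nonempty ι]
    (p r s : ℝ≥0∞) [Fact (1 ≤ p)] [Fact (1 ≤ r)] [Fact (1 ≤ s)]
    (hp : 2 < p) (hp' : p < ∞) (hr : r < ∞) (hs : s < ∞)
    (ρ : FunctionNorm ι) (hρ : ρ.IsNormalized)
    (hembed : IsomorphicallyEmbeds 𝕜 (ρ.Space 𝕜 (lp (fun _ : ℕ => 𝕜) p)) (MixedLp 𝕜 s r)) :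
    (min r s ≤ p ∧ p ≤ max r s) ∧
      (r ≤ s → p ≠ r → p = s ∧ ρ.LatticeIsoLp 𝕜 p) := by
  have hp2 : 2 < p.toReal := by
    simpa using (ENNReal.toReal_lt_toReal ENNReal.ofNat_ne_top hp'.ne).2 hp
  have hmin : min r s ≤ p :=
    (ENNReal.toReal_le_toReal (ne_top_of_le_ne_top hr.ne (min_le_left _ _)) hp'.ne).1
      (min_le_of_embeds_mixedLp hp2 hr.ne hs.ne hρ hembed)
  have hlt : r < p → p = s ∧ ρ.LatticeIsoLp 𝕜 p := fun hrp => by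
    have h := eq_and_latticeIsoLp_of_embeds_mixedLp hp2
      ((ENNReal.toReal_lt_toReal hr.ne hp'.ne).2 hrp) hr.ne hs.ne hρ hembed
    exact ⟨(ENNReal.toReal_eq_toReal_iff' hp'.ne hs.ne).1 h.1, h.2⟩
  refine ⟨⟨hmin, ?_⟩, fun hrs hpr => hlt (lt_of_le_of_ne ?_ hpr.symm)⟩
  · rcases lt_or_ge r p with h | h
    · exact (hlt h).1.le.trans (le_max_right _ _)
    · exact h.trans (le_max_left _ _)
  · rwa [min_eq_left hrs] at hmin
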